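/- Let $k\ge 2$ and let $\sigma=\sigma_0\sigma_1\cdots\sigma_{k-1}\in\{+,-\}^k$. Let $\mathcal W_k$ be the set of infinite words $w=w_1w_2\cdots$ over $\{0,\dots,k-1\}$, and write $w_{[i,j]}=w_i\cdots w_j$, $w_{[i,\infty)}=w_iw_{i+1}\cdots$. Order $\mathcal W_k$ by: $v\prec_\sigma w$ if $v_1<w_1$, or $v_1=w_1$, $\sigma_{v_1}=+$ and $v_{[2,\infty)}\prec_\sigma w_{[2,\infty)}$, or $v_1=w_1$, $\sigma_{v_1}=-$ and $w_{[2,\infty)}\prec_\sigma v_{[2,\infty)}$ (so two different words are compared after finitely many steps). Let $\Sigma_\sigma$ be the shift $w_1w_2w_3\cdots\mapsto w_2w_3\cdots$. The smallest and largest words of $\mathcal W_k$ are $$\omega_\sigma=\begin{cases}0^\infty&\sigma_0=+,\\0(k-1)^\infty&\sigma_0=-,\ \sigma_{k-1}=+,\\(0(k-1))^\infty&\sigma_0=\sigma_{k-1}=-,\end{cases}\qquad \Omega_\sigma=\begin{cases}(k-1)^\infty&\sigma_{k-1}=+,\\(k-1)0^\infty&\sigma_{k-1}=-,\ \sigma_0=+,\\((k-1)0)^\infty&\sigma_0=\sigma_{k-1}=-.\end{cases}$$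 Let $n\ge1$ and let $\pi=\pi_1\cdots\pi_n$ be a permutation of $\{1,\dots,n\}$. A word $w$ *induces* $\pi$, written $\mathrm{Pat}(w,\Sigma_\sigma,n)=\pi$, if the words $w_{[1,\infty)},\dots,w_{[n,\infty)}$ are distinct and $w_{[i,\infty)}\prec_\sigma w_{[j,\infty)}\iff\pi_i<\pi_j$. Put $\mathrm{Int}(\pi,\Sigma_\sigma)=\{w\in\mathcal W_k:\mathrm{Pat}(w,\Sigma_\sigma,n)=\pi\}$. Define $\hat\pi^\star=\hat\pi^\star_1\cdots\hat\pi^\star_n$ by $\hat\pi^\star_{\pi_i}=\pi_{i+1}$ for $i<n$ and $\hat\pi^\star_{\pi_n}=\star$. A *$\sigma$-segmentation* of $\hat\pi^\star$ is a sequence $E=(e_0,\dots,e_k)$ of integers with $0=e_0\le e_1\le\cdots\le e_k=n$ such that (a) for $0\le t\le k-1$, the sequence $\hat\pi^\star_{e_t+1}\cdots\hat\pi^\star_{e_{t+1}}$, with $\star$ deleted if present, is increasing if $\sigma_t=+$ and decreasing if $\sigma_t=-$; (b) if $\sigma_0=+$ and $\hat\pi^\star_1\hat\pi^\star_2=\star1$,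 then $e_1=0$; (c) if $\sigma_{k-1}=+$ and $\hat\pi^\star_{n-1}\hat\pi^\star_n=n\star$, then $e_{k-1}=n-1$; (d) if $\sigma_0=\sigma_{k-1}=-$, $\hat\pi^\star_1=n$ and $\hat\pi^\star_{n-1}\hat\pi^\star_n=1\star$, then $e_1=0$ or $e_{k-1}=n-1$; (e) if $\sigma_0=\sigma_{k-1}=-$, $\hat\pi^\star_1\hat\pi^\star_2=\star n$ and $\hat\pi^\star_n=1$, then $e_1=0$ or $e_{k-1}=n$; (f) $e_t\ne\pi_n$ for $1\le t\le k-1$. Its *associated prefix* is the word $\zeta=z_1\cdots z_{n-1}$ with $z_i=j$ whenever $e_j<\pi_i\le e_{j+1}$. If $\pi_n\ne n$, let $x$ be the index with $\pi_x=\pi_n+1$ and $p=z_x\cdots z_{n-1}$; if $\pi_n\ne1$, let $y$ be the index with $\pi_y=\pi_n-1$ and $q=z_y\cdots z_{n-1}$. The segmentation is *invalid* if $\pi_n\notin\{1,n\}$ and ($p=q^2$ or $q=p^2$), and *valid* otherwise. Write $d^\infty$ for the infinite repetition of a finite word $d$. For a segmentation $E$, say that a word $v\in\mathcal W_k$ is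 *admissible for $E$* if both of the following hold: * $q^\infty\prec_\sigma v$ if $\pi_n\ne1$, and $\omega_\sigma\preceq_\sigma v$ if $\pi_n=1$; * $v\prec_\sigma p^\infty$ if $\pi_n\ne n$, and $v\preceq_\sigma\Omega_\sigma$ if $\pi_n=n$. **Theorem.** For every $w\in\mathcal W_k$: $\mathrm{Pat}(w,\Sigma_\sigma,n)=\pi$ if and only if there is a valid $\sigma$-segmentation $E$ of $\hat\pi^\star$ with associated prefix $\zeta=w_{[1,n-1]}$ such that $w_{[n,\infty)}$ is admissible for $E$. Moreover $$\mathrm{Int}(\pi,\Sigma_\sigma)=\bigcup_{E}\{\zeta v: v\in\mathcal W_k\text{ admissible for }E\},$$ where $E$ ranges over the valid $\sigma$-segmentations of $\hat\pi^\star$ and $\zeta$ is the prefix of $E$. There are finitely many such $E$, the sets in the union are pairwise disjoint for different $E$, and each of them is a nonempty interval of $(\mathcal W_k,\prec_\sigma)$, that is, a nonempty set of one of the forms $(u,v)$, $[u,v)$, $(u,v]$, $[u,v]$ with $u,v\in\mathcal W_k$. -/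

import Mathlib

/-! Patterns of signed shifts.  The alphabet is `{0, …, r}`, so it has `k = r + 1` letters, and the
permutations have length `n = m + 1`.  Words and one-line notations are indexed from `0`: the letter
`w i` is the `(i + 1)`-st letter of `w`, and the entry `π i` is the `(i + 1)`-st entry of `π`, minus
one. -/

namespace SignedShift

/-- A signature: the sign (`1` for plus, `-1` for minus) of each letter. -/
abbrev Signature (r : ℕ) : Type := Fin (r + 1) → ℤˣ

/-- Infinite words on the alphabet `{0, …, r}`. -/
abbrev Word (r : ℕ) : Type := ℕ → Fin (r + 1)

/-- The shift map, which deletes the first letter. -/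
def shift {r : ℕ} (w : Word r) : Word r := fun i => w (i + 1)

/-- The strict order on words that belongs to a signature. -/
inductive Less {r : ℕ} (σ : Signature r) : Word r → Word r → Prop
  | head (v w : Word r) : v 0 < w 0 → Less σ v w
  | plus (v w : Word r) : v 0 = w 0 → σ (v 0) = 1 → Less σ (shift v) (shift w) → Less σ v w
  | minus (v w : Word r) : v 0 = w 0 → σ (v 0) = -1 → Less σ (shift w) (shift v) → Less σ v w

/-- The weak order on words that belongs to a signature. -/
def LessEq {r : ℕ} (σ : Signature r) (v w : Word r) : Prop := Less σ v w ∨ v = w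

/-- The point `x` induces the pattern `π` under `f`, with respect to the strict order `lt`: the first
`m + 1` points of its orbit are distinct and are in the same relative order as the entries of `π`. -/
def HasPattern {X : Type*} (lt : X → X → Prop) (f : X → X) (x : X) {m : ℕ}
    (π : Equiv.Perm (Fin (m + 1))) : Prop :=
  Function.Injective (fun i : Fin (m + 1) => f^[(i : ℕ)] x) ∧
    ∀ i j : Fin (m + 1), lt (f^[(i : ℕ)] x) (f^[(j : ℕ)] x) ↔ π i < π j

/-- The words that induce `π` under the signed shift. -/
def inducing {r m : ℕ} (σ : Signature r) (π : Equiv.Perm (Fin (m + 1))) : Set (Word r) :=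
  {w | HasPattern (Less σ) shift w π}

/-- The constant word `c c c …`. -/
def constWord {r : ℕ} (c : Fin (r + 1)) : Word r := fun _ => c

/-- The word `c v`. -/
def consWord {r : ℕ} (c : Fin (r + 1)) (v : Word r) : Word r
  | 0 => c
  | i + 1 => v i

/-- The word `c d c d c d …`. -/
def altWord {r : ℕ} (c d : Fin (r + 1)) : Word r := fun i => if Even i then c else d

/-- The largest word. -/
def maxWord {r : ℕ} (σ : Signature r) : Word r :=
  if σ (Fin.last r) = 1 then constWord (Fin.last r)
  else if σ 0 = 1 then consWord (Fin.last r) (constWord 0)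
  else altWord (Fin.last r) 0

/-- The smallest word. -/
def minWord {r : ℕ} (σ : Signature r) : Word r :=
  if σ 0 = 1 then constWord 0
  else if σ (Fin.last r) = 1 then consWord 0 (constWord (Fin.last r))
  else altWord 0 (Fin.last r)

/-- The marked cycle of `π`: the entry at position `j` is the entry to the right of `j` in the
one-line notation of `π`, and `none` (the star) if `j` is the last entry of `π`. -/
def markedCycle {m : ℕ} (π : Equiv.Perm (Fin (m + 1))) (j : Fin (m + 1)) : Option (Fin (m + 1)) :=
  if h : (π.symm j : ℕ) < m then some (π ⟨(π.symm j : ℕ) + 1, by omega⟩) else none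

/-- Segmentations `0 = e_0 ≤ e_1 ≤ … ≤ e_k = n` of the marked cycle of `π`, where `n = m + 1` and
`k = r + 1`.  As positions are counted from `0`, the block of the letter `t` consists of the
positions `j` with `e_t ≤ j < e_{t+1}`. -/
structure Segmentation {r m : ℕ} (σ : Signature r) (π : Equiv.Perm (Fin (m + 1))) where
  /-- The indices `e_0, …, e_k`. -/
  e : Fin (r + 2) → ℕ
  e_zero : e 0 = 0
  e_mono : Monotone e
  e_last : e (Fin.last (r + 1)) = m + 1
  /-- Apart from the star, each block is increasing or decreasing, according to the sign. -/
  block : ∀ (t : Fin (r + 1)) (i j a b : Fin (m + 1)),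
    e t.castSucc ≤ i → i < j → (j : ℕ) < e t.succ →
    markedCycle π i = some a → markedCycle π j = some b →
    (σ t = 1 → a < b) ∧ (σ t = -1 → b < a)
  /-- If the marked cycle starts with a star and then the smallest entry. -/
  start_plus : σ 0 = 1 → markedCycle π 0 = none → markedCycle π 1 = some 0 → e 1 = 0
  /-- If the marked cycle ends with the largest entry and then a star. -/
  end_plus : σ (Fin.last r) = 1 → markedCycle π (Fin.last m - 1) = some (Fin.last m) →
    markedCycle π (Fin.last m) = none → e (Fin.last r).castSucc = m
  /-- If the marked cycle starts with the largest entry and ends with the smallest and a star. -/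
  minus_end : σ 0 = -1 → σ (Fin.last r) = -1 → markedCycle π 0 = some (Fin.last m) →
    markedCycle π (Fin.last m - 1) = some 0 → markedCycle π (Fin.last m) = none →
    e 1 = 0 ∨ e (Fin.last r).castSucc = m
  /-- If the marked cycle starts with a star and the largest entry and ends with the smallest. -/
  minus_start : σ 0 = -1 → σ (Fin.last r) = -1 → markedCycle π 0 = none →
    markedCycle π 1 = some (Fin.last m) → markedCycle π (Fin.last m) = some 0 →
    e 1 = 0 ∨ e (Fin.last r).castSucc = m + 1
  /-- No inner index is at the star. -/
  ne_star : ∀ t : Fin (r + 2), t ≠ 0 → t ≠ Fin.last (r + 1) → e t ≠ (π (Fin.last m) : ℕ) + 1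

/-- Each position lies in exactly one block. -/
theorem Segmentation.existsUnique_block {r m : ℕ} {σ : Signature r}
    {π : Equiv.Perm (Fin (m + 1))} (E : Segmentation σ π) (j : Fin (m + 1)) :
    ∃! t : Fin (r + 1), E.e t.castSucc ≤ j ∧ (j : ℕ) < E.e t.succ := by
  have key : ∀ l : ℕ, ∀ hl : l < r + 2, (j : ℕ) < E.e ⟨l, hl⟩ →
      ∃ t : Fin (r + 1), E.e t.castSucc ≤ j ∧ (j : ℕ) < E.e t.succ := by
    intro l
    induction l with
    | zero =>
      intro hl h
      have h0 : E.e ⟨0, hl⟩ = 0 := E.e_zero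
      omega
    | succ l ih =>
      intro hl h
      by_cases h' : (j : ℕ) < E.e ⟨l, by omega⟩
      · exact ih (by omega) h'
      · exact ⟨⟨l, by omega⟩, not_lt.mp h', h⟩
  obtain ⟨t, h1, h2⟩ := key (r + 1) (by omega) (by
    have h : E.e ⟨r + 1, by omega⟩ = m + 1 := E.e_last
    rw [h]
    exact j.isLt)
  refine ⟨t, ⟨h1, h2⟩, ?_⟩
  rintro s ⟨h3, h4⟩
  by_contra hne
  rcases lt_or_gt_of_ne hne with h | h
  · have := E.e_mono (show s.succ ≤ t.castSucc from h)
    omega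
  · have := E.e_mono (show t.succ ≤ s.castSucc from h)
    omega

/-- The associated word (prefix) of a segmentation: its `i`-th letter is the `t` whose block contains
the position `π i`. -/
noncomputable def Segmentation.assocWord {r m : ℕ} {σ : Signature r}
    {π : Equiv.Perm (Fin (m + 1))} (E : Segmentation σ π) (i : Fin m) : Fin (r + 1) :=
  (E.existsUnique_block (π i.castSucc)).choose

/-- The word `p`: the suffix of the associated word that starts at the index of the entry
`π_n + 1`.  It is only used when `π_n` is not the largest entry. -/
noncomputable def Segmentation.p {r m : ℕ} {σ : Signature r}
    {π : Equiv.Perm (Fin (m + 1))} (E : Segmentation σ π) : List (Fin (r + 1)) :=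
  (List.ofFn E.assocWord).drop (π.symm (π (Fin.last m) + 1))

/-- The word `q`: the suffix of the associated word that starts at the index of the entry
`π_n - 1`.  It is only used when `π_n` is not the smallest entry. -/
noncomputable def Segmentation.q {r m : ℕ} {σ : Signature r}
    {π : Equiv.Perm (Fin (m + 1))} (E : Segmentation σ π) : List (Fin (r + 1)) :=
  (List.ofFn E.assocWord).drop (π.symm (π (Fin.last m) - 1))

/-- Valid segmentations. -/
def Segmentation.Valid {r m : ℕ} {σ : Signature r}
    {π : Equiv.Perm (Fin (m + 1))} (E : Segmentation σ π) : Prop :=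
  ¬ (π (Fin.last m) ≠ 0 ∧ π (Fin.last m) ≠ Fin.last m ∧ (E.p = E.q ++ E.q ∨ E.q = E.p ++ E.p))

/-- The periodic word `d d d …`, for a nonempty finite word `d`. -/
def periodicWord {r : ℕ} (d : List (Fin (r + 1))) : Word r := fun i => d.getD (i % d.length) 0

/-- The lower bound on the tail: `q^∞`, exclusive, or the smallest word, inclusive, if `π_n` is the
smallest entry. -/
def Segmentation.LowerBound {r m : ℕ} {σ : Signature r}
    {π : Equiv.Perm (Fin (m + 1))} (E : Segmentation σ π) (v : Word r) : Prop :=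
  if π (Fin.last m) = 0 then LessEq σ (minWord σ) v else Less σ (periodicWord E.q) v

/-- The upper bound on the tail: `p^∞`, exclusive, or the largest word, inclusive, if `π_n` is the
largest entry. -/
def Segmentation.UpperBound {r m : ℕ} {σ : Signature r}
    {π : Equiv.Perm (Fin (m + 1))} (E : Segmentation σ π) (v : Word r) : Prop :=
  if π (Fin.last m) = Fin.last m then LessEq σ v (maxWord σ) else Less σ v (periodicWord E.p)

/-- The infinite word that consists of the finite word `z` followed by `v`. -/
def appendWord {r m : ℕ} (z : Fin m → Fin (r + 1)) (v : Word r) : Word r :=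
  fun i => if h : i < m then z ⟨i, h⟩ else v (i - m)

/-- The words that consist of the associated word of `E` and a tail between the two bounds. -/
def Segmentation.allowedInterval {r m : ℕ} {σ : Signature r}
    {π : Equiv.Perm (Fin (m + 1))} (E : Segmentation σ π) : Set (Word r) :=
  {w | ∃ v : Word r, E.LowerBound v ∧ E.UpperBound v ∧ w = appendWord E.assocWord v}

/-- Intervals of words: open, half-open or closed, with two words as endpoints. -/
def IsInterval {r : ℕ} (σ : Signature r) (S : Set (Word r)) : Prop :=
  ∃ u v : Word r,
    S = {w | Less σ u w ∧ Less σ w v} ∨ S = {w | LessEq σ u w ∧ Less σ w v} ∨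
    S = {w | Less σ u w ∧ LessEq σ w v} ∨ S = {w | LessEq σ u w ∧ LessEq σ w v}

theorem shift_minWord_plus {r : ℕ} (σ : Signature r) (h : σ 0 = 1) :
    shift (minWord σ) = minWord σ := by
  funext i
  simp [shift, minWord, h, constWord]

theorem shift_maxWord_plus {r : ℕ} (σ : Signature r) (h : σ (Fin.last r) = 1) :
    shift (maxWord σ) = maxWord σ := by
  funext i
  simp [shift, maxWord, h, constWord]

theorem shift_minWord_minus {r : ℕ} (σ : Signature r) (h : ¬ σ 0 = 1) :
    shift (minWord σ) = maxWord σ := by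
  funext i
  by_cases h' : σ (Fin.last r) = 1
  · simp [shift, minWord, maxWord, h, h', constWord, consWord]
  · by_cases hi : Even i <;>
      simp [shift, minWord, maxWord, h, h', altWord, Nat.even_add_one, hi]

theorem shift_maxWord_minus {r : ℕ} (σ : Signature r) (h : ¬ σ (Fin.last r) = 1) :
    shift (maxWord σ) = minWord σ := by
  funext i
  by_cases h' : σ 0 = 1
  · simp [shift, minWord, maxWord, h, h', constWord, consWord]
  · by_cases hi : Even i <;>
      simp [shift, minWord, maxWord, h, h', altWord, Nat.even_add_one, hi]

theorem minWord_zero {r : ℕ} (σ : Signature r) : minWord σ 0 = 0 := by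
  unfold minWord
  split_ifs <;> simp [constWord, consWord, altWord]

theorem maxWord_zero {r : ℕ} (σ : Signature r) : maxWord σ 0 = Fin.last r := by
  unfold maxWord
  split_ifs <;> simp [constWord, consWord, altWord]

theorem less_of_ne {r : ℕ} (σ : Signature r) (N : ℕ) : ∀ v : Word r,
    (v N ≠ minWord σ N → Less σ (minWord σ) v) ∧ (v N ≠ maxWord σ N → Less σ v (maxWord σ)) := by
  induction N with
  | zero =>
    intro v
    refine ⟨fun h => .head _ _ ?_, fun h => .head _ _ ?_⟩
    · rw [minWord_zero] at *
      exact Fin.pos_of_ne_zero h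
    · rw [maxWord_zero] at *
      exact lt_of_le_of_ne (Fin.le_last _) h
  | succ N ih =>
    intro v
    constructor
    · intro h
      by_cases h0 : v 0 = 0
      · have e0 : minWord σ 0 = v 0 := by rw [minWord_zero, h0]
        have h' : shift v N ≠ shift (minWord σ) N := h
        by_cases hs : σ 0 = 1
        · refine .plus _ _ e0 (by rw [minWord_zero, hs]) ?_
          rw [shift_minWord_plus σ hs] at *
          exact (ih _).1 h'
        · refine .minus _ _ e0 (by
            rw [minWord_zero]
            exact (Int.units_eq_one_or _).resolve_left hs) ?_
          rw [shift_minWord_minus σ hs] at *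
          exact (ih _).2 h'
      · refine .head _ _ ?_
        rw [minWord_zero]
        exact Fin.pos_of_ne_zero h0
    · intro h
      by_cases h0 : v 0 = Fin.last r
      · have e0 : v 0 = maxWord σ 0 := by rw [maxWord_zero, h0]
        have h' : shift v N ≠ shift (maxWord σ) N := h
        by_cases hs : σ (Fin.last r) = 1
        · refine .plus _ _ e0 (by rw [h0, hs]) ?_
          rw [shift_maxWord_plus σ hs] at *
          exact (ih _).2 h'
        · refine .minus _ _ e0 (by
            rw [h0]
            exact (Int.units_eq_one_or _).resolve_left hs) ?_
          rw [shift_maxWord_minus σ hs] at *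
          exact (ih _).1 h'
      · refine .head _ _ ?_
        rw [maxWord_zero]
        exact lt_of_le_of_ne (Fin.le_last _) h0

/-- The word `minWord σ` is indeed the smallest word. -/
theorem minWord_lessEq {r : ℕ} (σ : Signature r) (v : Word r) : LessEq σ (minWord σ) v := by
  by_cases h : minWord σ = v
  · exact Or.inr h
  · obtain ⟨N, hN⟩ := Function.ne_iff.mp h
    exact Or.inl ((less_of_ne σ N v).1 (Ne.symm hN))

/-- The word `maxWord σ` is indeed the largest word. -/
theorem lessEq_maxWord {r : ℕ} (σ : Signature r) (v : Word r) : LessEq σ v (maxWord σ) := by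
  by_cases h : v = maxWord σ
  · exact Or.inr h
  · obtain ⟨N, hN⟩ := Function.ne_iff.mp h
    exact Or.inl ((less_of_ne σ N v).2 hN)

end SignedShift

namespace SignedShift

/-! Let `m` be the index of the last entry of `π`, let `x` and `y` be the indices of the entries
just above and just below it, and let `v` be the tail of `w` at `m`. If `w` induces `π`, its first
`m` letters grow weakly with the entries, and equal letters preserve or reverse the order of the
following entries according to their sign. This is `Follows`, and it is what the blocks of a
segmentation encode.

Conversely, suppose that `Follows` holds and that two tails at indices below `m` are in the wrong
order. Dropping their first letters gives another wrong pair that differs one place earlier. This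
descent can only be stopped by the index `m`, and there the neighbours `x` and `y` can take its
place. So `w` induces `π` exactly when `v` lies strictly between its tails at `y` and `x`
(`Follows.hasPattern`). The tail at `x` is `p v`, and `v` compares to `p v` as it does to `p^∞`
(`periodic_compare`); the same holds for `q`. This yields the bounds.

A word that induces `π` gives a segmentation by counting letters, the star being labelled like its
right neighbour (`exists_segmentation`). If one of the conditions (b) to (e) failed, `v` would lie
beyond the smallest or the largest word. Condition (f) makes the segmentation recoverable from its
prefix, whence finiteness and disjointness. An invalid segmentation has `p^∞ = q^∞`, hence no
admissible tail.

It remains to find a tail for each valid segmentation. The descent with tail `p^∞` gives `q^∞ ≤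
p^∞`. If these were equal, `p` and `q` would be powers of one word of length `g`, and the entries
read backwards from `m` in steps of `g` would form a monotone sequence or an alternating spiral.
Only an outward spiral has terms just above and just below its first one, and they are its next two
terms, so one of `p`, `q` is the square of the other. If `π_n` is extreme, conditions (b) to (e)
keep `p^∞` or `q^∞` away from the extreme word. Finally, prefixing a finite word is monotone or
antitone with convex image, so intervals go to intervals. -/

theorem iterate_shift_apply {r : ℕ} (w : Word r) (k i : ℕ) : (shift^[k] w) i = w (i + k) := by
  induction k generalizing w with
  | zero => rfl
  | succ k ih => rw [Function.iterate_succ_apply, ih, shift]; rfl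

/-- The product of the signs of the first `N` letters of a word. -/
def prefixSign {r : ℕ} (σ : Signature r) (v : Word r) (N : ℕ) : ℤˣ :=
  ∏ i ∈ Finset.range N, σ (v i)

/-- The words `v` and `w` first differ at the index `N`, where `v` is the smaller one. -/
def LessAt {r : ℕ} (σ : Signature r) (N : ℕ) (v w : Word r) : Prop :=
  (∀ i < N, v i = w i) ∧
    ((prefixSign σ v N = 1 ∧ v N < w N) ∨ (prefixSign σ v N = -1 ∧ w N < v N))

/-! ### The signed order through first differences -/

section Order

variable {r : ℕ} {σ : Signature r}

theorem prefixSign_congr {v w : Word r} {N : ℕ} (h : ∀ i < N, v i = w i) :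
    prefixSign σ v N = prefixSign σ w N :=
  Finset.prod_congr rfl fun i hi => by rw [h i (Finset.mem_range.mp hi)]

theorem prefixSign_succ (v : Word r) (N : ℕ) :
    prefixSign σ v (N + 1) = prefixSign σ (shift v) N * σ (v 0) :=
  Finset.prod_range_succ' _ _

theorem prefixSign_add (v : Word r) (M N : ℕ) :
    prefixSign σ v (M + N) = prefixSign σ v M * prefixSign σ (shift^[M] v) N := by
  unfold prefixSign
  rw [Finset.prod_range_add]
  simp only [iterate_shift_apply, add_comm]

theorem units_neg_one_ne_one : ¬ (-1 : ℤˣ) = 1 := by decide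

theorem LessAt.congr {N : ℕ} {v w v' w' : Word r} (h : LessAt σ N v w)
    (hv : ∀ i ≤ N, v i = v' i) (hw : ∀ i ≤ N, w i = w' i) : LessAt σ N v' w' := by
  obtain ⟨h1, h2⟩ := h
  refine ⟨fun i hi => by rw [← hv i hi.le, ← hw i hi.le, h1 i hi], ?_⟩
  rw [← prefixSign_congr (fun i hi => hv i (le_of_lt hi)), ← hv N le_rfl, ← hw N le_rfl]
  exact h2

theorem LessAt.ne {N : ℕ} {v w : Word r} (h : LessAt σ N v w) : v N ≠ w N := by
  rcases h.2 with h | h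
  · exact h.2.ne
  · exact h.2.ne'

theorem lessAt_zero {v w : Word r} : LessAt σ 0 v w ↔ v 0 < w 0 := by
  simp [LessAt, prefixSign]

theorem lessAt_succ {N : ℕ} {v w : Word r} :
    LessAt σ (N + 1) v w ↔ v 0 = w 0 ∧ ((σ (v 0) = 1 ∧ LessAt σ N (shift v) (shift w)) ∨
      (σ (v 0) = -1 ∧ LessAt σ N (shift w) (shift v))) := by
  have key : (∀ i < N + 1, v i = w i) ↔ v 0 = w 0 ∧ ∀ i < N, shift v i = shift w i := by
    constructor
    · exact fun h => ⟨h 0 (by omega), fun i hi => h (i + 1) (by omega)⟩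
    · rintro ⟨h0, h⟩ (_ | i) hi
      · exact h0
      · exact h i (by omega)
  unfold LessAt
  rw [key, prefixSign_succ]
  have hs : (∀ i < N, shift v i = shift w i) →
      prefixSign σ (shift w) N = prefixSign σ (shift v) N :=
    fun h => (prefixSign_congr h).symm
  have comm : (∀ i < N, shift w i = shift v i) ↔ ∀ i < N, shift v i = shift w i :=
    forall₂_congr fun _ _ => eq_comm
  rw [comm]
  by_cases h0 : v 0 = w 0
  swap
  · simp [h0]
  by_cases h1 : ∀ i < N, shift v i = shift w i
  swap
  · simp [h1]
  rw [hs h1]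
  have e1 : shift v N = v (N + 1) := rfl
  have e2 : shift w N = w (N + 1) := rfl
  rw [e1, e2]
  generalize (∀ i < N, shift v i = shift w i) = Q at h1 ⊢
  generalize (v 0 = w 0) = Q' at h0 ⊢
  rcases Int.units_eq_one_or (σ (v 0)) with h | h <;>
    rcases Int.units_eq_one_or (prefixSign σ (shift v) N) with h' | h' <;>
    simp [h, h', h0, h1, eq_comm (a := (1 : ℤˣ))]

theorem less_iff_exists_lessAt {v w : Word r} : Less σ v w ↔ ∃ N, LessAt σ N v w := by
  constructor
  · intro h
    induction h with
    | head v w h => exact ⟨0, lessAt_zero.mpr h⟩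
    | plus v w h0 hs _ ih =>
      obtain ⟨N, hN⟩ := ih
      exact ⟨N + 1, lessAt_succ.mpr ⟨h0, Or.inl ⟨hs, hN⟩⟩⟩
    | minus v w h0 hs _ ih =>
      obtain ⟨N, hN⟩ := ih
      exact ⟨N + 1, lessAt_succ.mpr ⟨h0, Or.inr ⟨hs, hN⟩⟩⟩
  · rintro ⟨N, hN⟩
    induction N generalizing v w with
    | zero => exact .head _ _ (lessAt_zero.mp hN)
    | succ N ih =>
      obtain ⟨h0, ⟨hs, h⟩ | ⟨hs, h⟩⟩ := lessAt_succ.mp hN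
      · exact .plus _ _ h0 hs (ih h)
      · exact .minus _ _ h0 hs (ih h)

theorem LessAt.less {N : ℕ} {v w : Word r} (h : LessAt σ N v w) : Less σ v w :=
  less_iff_exists_lessAt.mpr ⟨N, h⟩

/-- The index matters as well as the order: in `Follows.hasPattern` a tail is exchanged for a
neighbouring one without raising the place of the first difference. -/
theorem LessAt.trans_lessAt {M N : ℕ} {a b c : Word r} (h : LessAt σ M a b)
    (h' : LessAt σ N b c) : LessAt σ (min M N) a c := by
  rcases lt_trichotomy M N with hMN | rfl | hMN
  · rw [min_eq_left hMN.le]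
    exact h.congr (fun _ _ => rfl) fun i hi => h'.1 i (by omega)
  · rw [min_self]
    refine ⟨fun i hi => (h.1 i hi).trans (h'.1 i hi), ?_⟩
    have hs := prefixSign_congr (σ := σ) h.1
    rcases h.2 with ⟨h1, h2⟩ | ⟨h1, h2⟩ <;> rcases h'.2 with ⟨h3, h4⟩ | ⟨h3, h4⟩
    · exact Or.inl ⟨h1, h2.trans h4⟩
    · rw [hs, h3] at h1
      exact absurd h1 units_neg_one_ne_one
    · rw [hs, h3] at h1
      exact absurd h1.symm units_neg_one_ne_one
    · exact Or.inr ⟨h1, h4.trans h2⟩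
  · rw [min_eq_right hMN.le]
    exact h'.congr (fun i hi => (h.1 i (by omega)).symm) fun _ _ => rfl

theorem Less.trans {a b c : Word r} (h : Less σ a b) (h' : Less σ b c) : Less σ a c := by
  obtain ⟨M, hM⟩ := less_iff_exists_lessAt.mp h
  obtain ⟨N, hN⟩ := less_iff_exists_lessAt.mp h'
  exact (hM.trans_lessAt hN).less

theorem Less.irrefl (a : Word r) : ¬ Less σ a a := by
  intro h
  obtain ⟨N, hN⟩ := less_iff_exists_lessAt.mp h
  exact hN.ne rfl

theorem Less.asymm {a b : Word r} (h : Less σ a b) : ¬ Less σ b a :=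
  fun h' => Less.irrefl a (h.trans h')

theorem less_trichotomy (σ : Signature r) (a b : Word r) :
    Less σ a b ∨ a = b ∨ Less σ b a := by
  classical
  by_cases h : a = b
  · exact Or.inr (Or.inl h)
  have hex : ∃ N, a N ≠ b N := Function.ne_iff.mp h
  have hne := Nat.find_spec hex
  have hlt : ∀ i < Nat.find hex, a i = b i := fun i hi => not_not.mp (Nat.find_min hex hi)
  have hs := prefixSign_congr (σ := σ) hlt
  set N := Nat.find hex
  rcases Int.units_eq_one_or (prefixSign σ a N) with h1 | h1 <;>
    rcases lt_or_gt_of_ne hne with h2 | h2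
  · exact Or.inl (LessAt.less ⟨hlt, Or.inl ⟨h1, h2⟩⟩)
  · exact Or.inr (Or.inr (LessAt.less ⟨fun i hi => (hlt i hi).symm, Or.inl ⟨hs ▸ h1, h2⟩⟩))
  · exact Or.inr (Or.inr (LessAt.less ⟨fun i hi => (hlt i hi).symm, Or.inr ⟨hs ▸ h1, h2⟩⟩))
  · exact Or.inl (LessAt.less ⟨hlt, Or.inr ⟨h1, h2⟩⟩)

theorem not_less {a b : Word r} : ¬ Less σ a b ↔ LessEq σ b a := by
  constructor
  · intro h
    rcases less_trichotomy σ a b with h' | h' | h'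
    · exact absurd h' h
    · exact Or.inr h'.symm
    · exact Or.inl h'
  · rintro (h | rfl)
    · exact h.asymm
    · exact Less.irrefl _

theorem Less.trans_lessEq {a b c : Word r} (h : Less σ a b) (h' : LessEq σ b c) :
    Less σ a c := by
  rcases h' with h' | rfl
  · exact h.trans h'
  · exact h

theorem LessEq.trans_less {a b c : Word r} (h : LessEq σ a b) (h' : Less σ b c) :
    Less σ a c := by
  rcases h with h | rfl
  · exact h.trans h'
  · exact h'

theorem Less.head_le {a b : Word r} (h : Less σ a b) : a 0 ≤ b 0 := by
  cases h with
  | head _ _ h => exact h.le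
  | plus _ _ h => exact h.le
  | minus _ _ h => exact h.le

theorem Less.shift_of_plus {a b : Word r} (h : Less σ a b) (h0 : a 0 = b 0) (hs : σ (a 0) = 1) :
    Less σ (shift a) (shift b) := by
  cases h with
  | head _ _ h => exact absurd h0 h.ne
  | plus _ _ _ _ h => exact h
  | minus _ _ _ h' _ => rw [hs] at h'; exact absurd h'.symm units_neg_one_ne_one

theorem Less.shift_of_minus {a b : Word r} (h : Less σ a b) (h0 : a 0 = b 0)
    (hs : σ (a 0) = -1) : Less σ (shift b) (shift a) := by
  cases h with
  | head _ _ h => exact absurd h0 h.ne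
  | plus _ _ _ h' _ => rw [hs] at h'; exact absurd h' units_neg_one_ne_one
  | minus _ _ _ _ h => exact h

/-- Two words with a common prefix compare as the tails do, up to the sign of the prefix. -/
theorem less_iff_of_prefix (N : ℕ) {a b : Word r} (h : ∀ i < N, a i = b i) :
    Less σ a b ↔ (prefixSign σ a N = 1 ∧ Less σ (shift^[N] a) (shift^[N] b)) ∨
      (prefixSign σ a N = -1 ∧ Less σ (shift^[N] b) (shift^[N] a)) := by
  induction N generalizing a b with
  | zero => simp [prefixSign]
  | succ N ih =>
    have h0 : a 0 = b 0 := h 0 (by omega)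
    have h' : ∀ i < N, shift a i = shift b i := fun i hi => h (i + 1) (by omega)
    have h'' : ∀ i < N, shift b i = shift a i := fun i hi => (h' i hi).symm
    rw [prefixSign_succ, Function.iterate_succ_apply, Function.iterate_succ_apply]
    rcases Int.units_eq_one_or (σ (a 0)) with hs | hs
    · have e : Less σ a b ↔ Less σ (shift a) (shift b) :=
        ⟨fun h => h.shift_of_plus h0 hs, .plus _ _ h0 hs⟩
      rw [e, ih h', hs, mul_one]
    · have e : Less σ a b ↔ Less σ (shift b) (shift a) :=
        ⟨fun h => h.shift_of_minus h0 hs, .minus _ _ h0 hs⟩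
      rw [e, ih h'', hs, prefixSign_congr h'']
      rcases Int.units_eq_one_or (prefixSign σ (shift a) N) with h1 | h1 <;>
        simp [h1, eq_comm (a := (1 : ℤˣ))]

/-- Let `c` have period `L`, and let `u` consist of the first `L` letters of `c`, followed by `v`.
Then `v` compares to `c` as it does to `u`. -/
theorem periodic_compare {L : ℕ} (hL : 0 < L) {c u v : Word r} (hc : ∀ i, c (i + L) = c i)
    (hu : ∀ i < L, u i = c i) (hv : shift^[L] u = v) :
    (Less σ v c ↔ Less σ v u) ∧ (Less σ c v ↔ Less σ u v) := by
  have huv : ∀ i, L ≤ i → u i = v (i - L) := fun i hi => by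
    rw [← hv, iterate_shift_apply, Nat.sub_add_cancel hi]
  have hcc : ∀ i, L ≤ i → c i = c (i - L) := fun i hi => by
    rw [← hc (i - L), Nat.sub_add_cancel hi]
  -- Both `c` and `u` start with the same `L` letters, and continue with `c` and with `v`
  -- respectively. As `L > 0`, agreement of `v` with one of them below `N` makes `c` and `u` agree
  -- up to and including `N`, so the first difference is the same for both.
  have h1 : ∀ N, (∀ i < N, v i = c i) → ∀ i ≤ N, c i = u i := by
    intro N h i hi
    rcases lt_or_ge i L with hiL | hiL
    · exact (hu i hiL).symm
    · rw [huv i hiL, h (i - L) (by omega), hcc i hiL]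
  have h2 : ∀ N, (∀ i < N, v i = u i) → ∀ i ≤ N, u i = c i := by
    intro N h i
    induction i using Nat.strong_induction_on with
    | _ i ih =>
      intro hi
      rcases lt_or_ge i L with hiL | hiL
      · exact hu i hiL
      · rw [huv i hiL, h (i - L) (by omega), ih (i - L) (by omega) (by omega), hcc i hiL]
  refine ⟨⟨fun h => ?_, fun h => ?_⟩, ⟨fun h => ?_, fun h => ?_⟩⟩ <;>
    obtain ⟨N, hN⟩ := less_iff_exists_lessAt.mp h
  · exact (hN.congr (fun _ _ => rfl) (h1 N hN.1)).less
  · exact (hN.congr (fun _ _ => rfl) (h2 N hN.1)).less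
  · exact (hN.congr (h1 N fun i hi => (hN.1 i hi).symm) (fun _ _ => rfl)).less
  · exact (hN.congr (h2 N fun i hi => (hN.1 i hi).symm) (fun _ _ => rfl)).less

/-- Above a periodic word there are words that are arbitrarily close to it. -/
theorem exists_between_of_periodic {L : ℕ} (hL : 0 < L) {a b : Word r}
    (ha : ∀ i, a (i + L) = a i) (h : Less σ a b) : ∃ c, Less σ a c ∧ Less σ c b := by
  obtain ⟨N, hN⟩ := less_iff_exists_lessAt.mp h
  have hper : ∀ k i, a (i + k * L) = a i := by
    intro k
    induction k with
    | zero => simp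
    | succ k ih => intro i; rw [Nat.succ_mul, ← add_assoc, ha, ih]
  have hshift : ∀ k, shift^[k * L] a = a := fun k => by
    funext i
    rw [iterate_shift_apply, hper]
  -- A multiple of the period beyond the first difference `N`. The word `c` below is `a` up to `2K`,
  -- then `b`; doubling `K` makes the sign of that prefix a square, so the tails `a` and `b` compare
  -- in the right direction.
  set K := (N + 1) * L with hK
  have hNK : N < K := by nlinarith
  have hsign : prefixSign σ a (K + K) = 1 := by
    rw [prefixSign_add, hK, hshift]
    exact Int.units_mul_self _
  refine ⟨fun i => if i < K + K then a i else b (i - (K + K)), ?_, ?_⟩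
  · rw [less_iff_of_prefix (K + K) (fun i hi => by simp [hi])]
    refine Or.inl ⟨hsign, ?_⟩
    convert h
    · rw [hK, ← Nat.add_mul, hshift]
    · funext i
      simp [iterate_shift_apply]
  · exact (hN.congr (fun i hi => by
      have : i < K + K := by omega
      simp [this]) (fun _ _ => rfl)).less

end Order

/-! ### Prefixing a finite word to an interval -/

section Interval

variable {r m : ℕ} {σ : Signature r}

theorem appendWord_apply_of_lt (z : Fin m → Fin (r + 1)) (v : Word r) {i : ℕ} (h : i < m) :
    appendWord z v i = z ⟨i, h⟩ := by
  simp [appendWord, h]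

theorem iterate_shift_appendWord (z : Fin m → Fin (r + 1)) (v : Word r) :
    shift^[m] (appendWord z v) = v := by
  funext i
  simp [iterate_shift_apply, appendWord]

theorem appendWord_eq_iff (z : Fin m → Fin (r + 1)) (v w : Word r) :
    w = appendWord z v ↔ (∀ i : Fin m, w i = z i) ∧ shift^[m] w = v := by
  constructor
  · rintro rfl
    exact ⟨fun i => appendWord_apply_of_lt z v i.isLt, iterate_shift_appendWord z v⟩
  · rintro ⟨h, rfl⟩
    funext i
    by_cases hi : i < m
    · rw [appendWord_apply_of_lt _ _ hi, ← h ⟨i, hi⟩]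
    · simp [appendWord, hi, iterate_shift_apply, Nat.sub_add_cancel (not_lt.mp hi)]

/-- The strict order or the weak order. -/
def Rel (σ : Signature r) (b : Prop) (v w : Word r) : Prop := Less σ v w ∨ b ∧ v = w

theorem Rel.lessEq {b : Prop} {v w : Word r} (h : Rel σ b v w) : LessEq σ v w :=
  h.imp_right And.right

theorem isInterval_rel (b b' : Prop) (u v : Word r) :
    IsInterval σ {w | Rel σ b u w ∧ Rel σ b' w v} := by
  refine ⟨u, v, ?_⟩
  by_cases hb : b <;> by_cases hb' : b' <;> simp [Rel, LessEq, hb, hb']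

/-- Cylinders are convex: if `w` left the common prefix, transitivity would make `a` and `b` differ
at an index below `N`. -/
theorem eq_of_lessEq_of_lessEq {N : ℕ} {a b w : Word r} (hab : ∀ i < N, a i = b i)
    (h1 : LessEq σ a w) (h2 : LessEq σ w b) : ∀ i < N, w i = a i := by
  rcases h1 with h1 | rfl
  swap
  · exact fun _ _ => rfl
  rcases h2 with h2 | rfl
  swap
  · exact fun i hi => (hab i hi).symm
  obtain ⟨K, hK⟩ := less_iff_exists_lessAt.mp h1
  obtain ⟨M, hM⟩ := less_iff_exists_lessAt.mp h2
  have hN : N ≤ min K M := by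
    by_contra hlt
    exact (hK.trans_lessAt hM).ne (hab _ (not_le.mp hlt))
  exact fun i hi => (hK.1 i (by omega)).symm

/-- The sign of `z` decides whether `v ↦ z v` preserves or reverses the order; in the second case
the endpoints change places. Convexity of the cylinder of `z` shows that no other words lie between
the images. -/
theorem isInterval_appendWord (z : Fin m → Fin (r + 1)) (b b' : Prop) (lo hi : Word r) :
    IsInterval σ {w | ∃ v, Rel σ b lo v ∧ Rel σ b' v hi ∧ w = appendWord z v} := by
  have hz : ∀ v v' : Word r, ∀ i < m, appendWord z v i = appendWord z v' i := fun v v' i h => by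
    rw [appendWord_apply_of_lt _ _ h, appendWord_apply_of_lt _ _ h]
  have hsign : ∀ v, prefixSign σ (appendWord z v) m = prefixSign σ (appendWord z lo) m :=
    fun v => prefixSign_congr (hz v lo)
  have hinj : ∀ v v' : Word r, appendWord z v = appendWord z v' ↔ v = v' := fun v v' =>
    ⟨fun h => by rw [← iterate_shift_appendWord z v, h, iterate_shift_appendWord],
      fun h => by rw [h]⟩
  have hpre : ∀ u v w : Word r, LessEq σ (appendWord z u) w → LessEq σ w (appendWord z v) →
      w = appendWord z (shift^[m] w) := fun u v w h1 h2 => by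
    refine (appendWord_eq_iff _ _ _).mpr ⟨fun i => ?_, rfl⟩
    rw [eq_of_lessEq_of_lessEq (hz u v) h1 h2 i i.isLt, appendWord_apply_of_lt]
  rcases Int.units_eq_one_or (prefixSign σ (appendWord z lo) m) with hs | hs
  · have hrel : ∀ (c : Prop) (v v' : Word r),
        Rel σ c (appendWord z v) (appendWord z v') ↔ Rel σ c v v' := fun c v v' => by
      simp only [Rel, hinj, less_iff_of_prefix m (hz v v'), hsign, hs, iterate_shift_appendWord]
      simp [eq_comm (a := (1 : ℤˣ))]
    convert isInterval_rel b b' (appendWord z lo) (appendWord z hi) using 1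
    ext w
    constructor
    · rintro ⟨v, h1, h2, rfl⟩
      exact ⟨(hrel _ _ _).mpr h1, (hrel _ _ _).mpr h2⟩
    · rintro ⟨h1, h2⟩
      have e := hpre _ _ _ h1.lessEq h2.lessEq
      rw [e] at h1 h2
      exact ⟨_, (hrel _ _ _).mp h1, (hrel _ _ _).mp h2, e⟩
  · have hrel : ∀ (c : Prop) (v v' : Word r),
        Rel σ c (appendWord z v') (appendWord z v) ↔ Rel σ c v v' := fun c v v' => by
      simp only [Rel, hinj, less_iff_of_prefix m (hz v' v), hsign, hs, iterate_shift_appendWord]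
      simp [eq_comm]
    convert isInterval_rel b' b (appendWord z hi) (appendWord z lo) using 1
    ext w
    constructor
    · rintro ⟨v, h1, h2, rfl⟩
      exact ⟨(hrel _ _ _).mpr h2, (hrel _ _ _).mpr h1⟩
    · rintro ⟨h1, h2⟩
      have e := hpre _ _ _ h1.lessEq h2.lessEq
      rw [e] at h1 h2
      exact ⟨_, (hrel _ _ _).mp h2, (hrel _ _ _).mp h1, e⟩

end Interval

end SignedShift

/-! ### Patterns and the descent on first differences -/

namespace SignedShift

/-- The entry of `π` at the index `i`, as a natural number. -/
def entry {m : ℕ} (π : Equiv.Perm (Fin (m + 1))) (i : ℕ) : ℕ := π (Fin.ofNat (m + 1) i)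

section Entry

variable {m : ℕ} (π : Equiv.Perm (Fin (m + 1)))

theorem entry_mk {i : ℕ} (h : i < m + 1) : entry π i = π ⟨i, h⟩ := by
  have : Fin.ofNat (m + 1) i = ⟨i, h⟩ := Fin.ext (Nat.mod_eq_of_lt h)
  rw [entry, this]

theorem entry_fin (i : Fin (m + 1)) : entry π i = π i := entry_mk π i.isLt

theorem entry_last : entry π m = π (Fin.last m) := entry_mk π (Nat.lt_succ_self m)

theorem entry_le (i : ℕ) : entry π i ≤ m := Nat.lt_succ_iff.mp (π _).isLt

variable {π}

theorem entry_inj {i j : ℕ} (hi : i ≤ m) (hj : j ≤ m) (h : entry π i = entry π j) : i = j := by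
  rw [entry_mk π (Nat.lt_succ_of_le hi), entry_mk π (Nat.lt_succ_of_le hj)] at h
  exact congrArg Fin.val (π.injective (Fin.ext h))

variable (π) in
theorem exists_entry_eq {c : ℕ} (hc : c ≤ m) : ∃ i ≤ m, entry π i = c := by
  refine ⟨π.symm ⟨c, Nat.lt_succ_of_le hc⟩, Nat.lt_succ_iff.mp (Fin.isLt _), ?_⟩
  rw [entry_fin, Equiv.apply_symm_apply]

end Entry

section Pattern

variable {r m : ℕ} {σ : Signature r} {π : Equiv.Perm (Fin (m + 1))} {w : Word r}

/-- One implication suffices: the entries are totally ordered and `Less` is asymmetric, which gives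
distinctness and the converse. -/
theorem hasPattern_iff : HasPattern (Less σ) shift w π ↔ ∀ i j, i ≤ m → j ≤ m →
    entry π i < entry π j → Less σ (shift^[i] w) (shift^[j] w) := by
  constructor
  · intro h i j hi hj hij
    have := (h.2 ⟨i, Nat.lt_succ_of_le hi⟩ ⟨j, Nat.lt_succ_of_le hj⟩).mpr
    rw [Fin.lt_def, ← entry_mk, ← entry_mk] at this
    exact this hij
  · intro h
    have h' : ∀ i j : Fin (m + 1), π i < π j → Less σ (shift^[(i : ℕ)] w) (shift^[(j : ℕ)] w) :=
      fun i j hij => h i j (Nat.lt_succ_iff.mp i.isLt) (Nat.lt_succ_iff.mp j.isLt) (by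
        rw [entry_fin, entry_fin]
        exact hij)
    constructor
    · intro i j hij
      by_contra hne
      dsimp only at hij
      rcases lt_or_gt_of_ne (π.injective.ne hne) with hlt | hlt
      · have := h' _ _ hlt
        rw [hij] at this
        exact Less.irrefl _ this
      · have := h' _ _ hlt
        rw [hij] at this
        exact Less.irrefl _ this
    · intro i j
      refine ⟨fun hl => ?_, h' i j⟩
      by_contra hlt
      rcases eq_or_lt_of_le (not_lt.mp hlt) with he | hlt
      · rw [π.injective he] at hl
        exact Less.irrefl _ hl
      · exact hl.asymm (h' _ _ hlt)

/-- The first `m` letters of `w` are compatible with `π`: they are weakly ordered as the entries,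
and two equal letters preserve or reverse the order of the entries, according to their sign. -/
structure Follows (σ : Signature r) (π : Equiv.Perm (Fin (m + 1))) (w : Word r) : Prop where
  le : ∀ i j, i < m → j < m → entry π i < entry π j → w i ≤ w j
  plus : ∀ i j, i < m → j < m → entry π i < entry π j → w i = w j → σ (w i) = 1 →
    entry π (i + 1) < entry π (j + 1)
  minus : ∀ i j, i < m → j < m → entry π i < entry π j → w i = w j → σ (w i) = -1 →
    entry π (j + 1) < entry π (i + 1)

theorem Follows.congr {w' : Word r} (h : Follows σ π w) (hw : ∀ i < m, w' i = w i) :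
    Follows σ π w' where
  le i j hi hj := by
    rw [hw i hi, hw j hj]
    exact h.le i j hi hj
  plus i j hi hj := by
    rw [hw i hi, hw j hj]
    exact h.plus i j hi hj
  minus i j hi hj := by
    rw [hw i hi, hw j hj]
    exact h.minus i j hi hj

theorem iterate_shift_zero (w : Word r) (i : ℕ) : (shift^[i] w) 0 = w i := by
  rw [iterate_shift_apply, zero_add]

theorem shift_iterate_shift (w : Word r) (i : ℕ) : shift (shift^[i] w) = shift^[i + 1] w :=
  (Function.iterate_succ_apply' shift i w).symm

theorem follows_of_hasPattern (h : HasPattern (Less σ) shift w π) : Follows σ π w := by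
  rw [hasPattern_iff] at h
  have key : ∀ i j, i ≤ m → j ≤ m → Less σ (shift^[i] w) (shift^[j] w) →
      entry π i < entry π j := by
    intro i j hi hj hl
    by_contra hlt
    rcases eq_or_lt_of_le (not_lt.mp hlt) with he | hlt
    · rw [entry_inj hj hi he] at hl
      exact Less.irrefl _ hl
    · exact hl.asymm (h _ _ hj hi hlt)
  constructor
  · intro i j hi hj hij
    have := (h i j hi.le hj.le hij).head_le
    rwa [iterate_shift_zero, iterate_shift_zero] at this
  · intro i j hi hj hij he hs
    have := (h i j hi.le hj.le hij).shift_of_plus (by simpa only [iterate_shift_zero] using he)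
      (by rwa [iterate_shift_zero])
    rw [shift_iterate_shift, shift_iterate_shift] at this
    exact key _ _ hi hj this
  · intro i j hi hj hij he hs
    have := (h i j hi.le hj.le hij).shift_of_minus (by simpa only [iterate_shift_zero] using he)
      (by rwa [iterate_shift_zero])
    rw [shift_iterate_shift, shift_iterate_shift] at this
    exact key _ _ hj hi this

/-- If two tails of `w` violate the order of `π`, then so do two tails that differ earlier. -/
theorem Follows.exists_violation (h : Follows σ π w) {N i j : ℕ} (hi : i < m) (hj : j < m)
    (hij : entry π i < entry π j) (hN : LessAt σ N (shift^[j] w) (shift^[i] w)) :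
    ∃ M < N, ∃ i' ≤ m, ∃ j' ≤ m, entry π i' < entry π j' ∧
      LessAt σ M (shift^[j'] w) (shift^[i'] w) := by
  have hle := h.le i j hi hj hij
  cases N with
  | zero =>
    rw [lessAt_zero, iterate_shift_zero, iterate_shift_zero] at hN
    exact absurd hle (not_le.mpr hN)
  | succ N =>
    rw [lessAt_succ, iterate_shift_zero, iterate_shift_zero, shift_iterate_shift,
      shift_iterate_shift] at hN
    obtain ⟨h0, ⟨hs, hN⟩ | ⟨hs, hN⟩⟩ := hN
    · exact ⟨N, Nat.lt_succ_self N, i + 1, hi, j + 1, hj,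
        h.plus i j hi hj hij h0.symm (h0 ▸ hs), hN⟩
    · exact ⟨N, Nat.lt_succ_self N, j + 1, hj, i + 1, hi,
        h.minus i j hi hj hij h0.symm (h0 ▸ hs), hN⟩

/-- Strong induction on the place `N` of the first difference of a wrong pair. If both indices are
below `m`, `exists_violation` lowers `N`. If one of them is `m`, the other is a neighbour,
contradicting `hx` or `hy`, or the neighbour replaces `m` without raising `N`. This gives the weak
order; strictness follows from the strict bounds on the tail at `m`. -/
theorem Follows.hasPattern (h : Follows σ π w)
    (hx : ∀ x < m, entry π x = entry π m + 1 → Less σ (shift^[m] w) (shift^[x] w))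
    (hy : ∀ y < m, entry π y + 1 = entry π m → Less σ (shift^[y] w) (shift^[m] w)) :
    HasPattern (Less σ) shift w π := by
  have next : ∀ j ≤ m, entry π m < entry π j → ∃ x < m, entry π x = entry π m + 1 ∧
      (x = j ∨ entry π x < entry π j) := by
    intro j hj hlt
    obtain ⟨x, hxm, hxe⟩ := exists_entry_eq π (c := entry π m + 1) (by
      have := entry_le π j
      omega)
    refine ⟨x, lt_of_le_of_ne hxm ?_, hxe, ?_⟩
    · rintro rfl
      omega
    · by_cases he : entry π x = entry π j
      · exact Or.inl (entry_inj hxm hj he)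
      · exact Or.inr (by omega)
  have prev : ∀ j ≤ m, entry π j < entry π m → ∃ y < m, entry π y + 1 = entry π m ∧
      (y = j ∨ entry π j < entry π y) := by
    intro j hj hlt
    obtain ⟨y, hym, hye⟩ := exists_entry_eq π (c := entry π m - 1) (by
      have := entry_le π m
      omega)
    refine ⟨y, lt_of_le_of_ne hym ?_, by omega, ?_⟩
    · rintro rfl
      omega
    · by_cases he : entry π y = entry π j
      · exact Or.inl (entry_inj hym hj he)
      · exact Or.inr (by omega)
  have weak : ∀ N, ∀ i ≤ m, ∀ j ≤ m, entry π i < entry π j →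
      ¬ LessAt σ N (shift^[j] w) (shift^[i] w) := by
    intro N
    induction N using Nat.strong_induction_on with
    | _ N ih =>
      have inner : ∀ K ≤ N, ∀ i < m, ∀ j < m, entry π i < entry π j →
          ¬ LessAt σ K (shift^[j] w) (shift^[i] w) := by
        intro K hK i hi j hj hij hl
        obtain ⟨M, hM, i', hi', j', hj', hij', hl'⟩ := h.exists_violation hi hj hij hl
        exact ih M (by omega) i' hi' j' hj' hij' hl'
      intro i hi j hj hij hl
      rcases Nat.lt_or_eq_of_le hi with him | rfl
      · rcases Nat.lt_or_eq_of_le hj with hjm | rfl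
        · exact inner N le_rfl i him j hjm hij hl
        · obtain ⟨y, hym, hye, rfl | hlt⟩ := prev i hi hij
          · exact (hy y hym hye).asymm hl.less
          · obtain ⟨K, hK⟩ := less_iff_exists_lessAt.mp (hy y hym hye)
            exact inner _ (min_le_right _ _) i him y hym hlt (hK.trans_lessAt hl)
      · obtain ⟨x, hxm, hxe, rfl | hlt⟩ := next j hj hij
        · exact (hx x hxm hxe).asymm hl.less
        · have hjm : j < i := lt_of_le_of_ne hj (by
            rintro rfl
            exact lt_irrefl _ hij)
          obtain ⟨K, hK⟩ := less_iff_exists_lessAt.mp (hx x hxm hxe)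
          exact inner _ (min_le_left _ _) x hxm j hjm hlt (hl.trans_lessAt hK)
  have weak' : ∀ i ≤ m, ∀ j ≤ m, entry π i < entry π j →
      LessEq σ (shift^[i] w) (shift^[j] w) := by
    intro i hi j hj hij
    rw [← not_less, less_iff_exists_lessAt]
    rintro ⟨N, hN⟩
    exact weak N i hi j hj hij hN
  have ne_last : ∀ i < m, shift^[i] w ≠ shift^[m] w := by
    intro i hi he
    rcases lt_trichotomy (entry π i) (entry π m) with hlt | heq | hlt
    · obtain ⟨y, hym, hye, rfl | hlt⟩ := prev i hi.le hlt
      · have := hy y hym hye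
        rw [he] at this
        exact Less.irrefl _ this
      · have := (weak' i hi.le y hym.le hlt).trans_less (hy y hym hye)
        rw [he] at this
        exact Less.irrefl _ this
    · exact hi.ne (entry_inj hi.le le_rfl heq)
    · obtain ⟨x, hxm, hxe, rfl | hlt⟩ := next i hi.le hlt
      · have := hx x hxm hxe
        rw [he] at this
        exact Less.irrefl _ this
      · have := (hx x hxm hxe).trans_lessEq (weak' x hxm.le i hi.le hlt)
        rw [he] at this
        exact Less.irrefl _ this
  have ne_of_lt : ∀ i j, i < j → j ≤ m → shift^[i] w ≠ shift^[j] w := by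
    intro i j hij hj he
    -- Shifting two equal tails until the later one starts at `m` reduces to an equality with the
    -- last tail.
    refine ne_last (m - j + i) (by omega) ?_
    rw [Function.iterate_add_apply, he, ← Function.iterate_add_apply, Nat.sub_add_cancel hj]
  refine hasPattern_iff.mpr fun i j hi hj hij => ?_
  rcases weak' i hi j hj hij with h' | h'
  · exact h'
  · rcases lt_trichotomy i j with hlt | rfl | hlt
    · exact absurd h' (ne_of_lt i j hlt hj)
    · exact absurd hij (lt_irrefl _)
    · exact absurd h'.symm (ne_of_lt j i hlt hi)

/-- If the tail is the tail at the next larger entry, then the order is still respected weakly. -/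
theorem Follows.lessEq_of_periodic (h : Follows σ π w) {x : ℕ} (hx : x < m)
    (hxe : entry π x = entry π m + 1) (hw : shift^[x] w = shift^[m] w) {i j : ℕ} (hi : i < m)
    (hj : j < m) (hij : entry π i < entry π j) : LessEq σ (shift^[i] w) (shift^[j] w) := by
  have weak : ∀ N, ∀ i < m, ∀ j < m, entry π i < entry π j →
      ¬ LessAt σ N (shift^[j] w) (shift^[i] w) := by
    intro N
    induction N using Nat.strong_induction_on with
    | _ N ih =>
      intro i hi j hj hij hl
      obtain ⟨M, hM, i', hi', j', hj', hij', hl'⟩ := h.exists_violation hi hj hij hl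
      -- The index `m` can be replaced by `x`, which has the same tail and the next larger entry.
      -- The pair stays in the same order unless the other index is `x` itself, and then the tails
      -- are equal.
      rcases Nat.lt_or_eq_of_le hi' with him | rfl
      · rcases Nat.lt_or_eq_of_le hj' with hjm | rfl
        · exact ih M hM i' him j' hjm hij' hl'
        · exact ih M hM i' him x hx (by omega) (hw ▸ hl')
      · have hjm : j' < i' := lt_of_le_of_ne hj' (by
          rintro rfl
          exact lt_irrefl _ hij')
        by_cases he : entry π x = entry π j'
        · rw [← entry_inj hx.le hj' he, hw] at hl'
          exact Less.irrefl _ hl'.less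
        · exact ih M hM x hx j' hjm (by omega) (hw ▸ hl')
  rw [← not_less, less_iff_exists_lessAt]
  rintro ⟨N, hN⟩
  exact weak N i hi j hj hij hN

end Pattern

end SignedShift

/-! ### From a segmentation to words: the bounds on the tail -/

namespace SignedShift

section MarkedCycle

variable {m : ℕ} {π : Equiv.Perm (Fin (m + 1))}

theorem markedCycle_eq_some_iff {j a : Fin (m + 1)} : markedCycle π j = some a ↔
    ∃ i < m, entry π i = j ∧ entry π (i + 1) = a := by
  unfold markedCycle
  constructor
  · intro h
    split_ifs at h with hlt
    refine ⟨π.symm j, hlt, ?_, ?_⟩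
    · rw [entry_fin, Equiv.apply_symm_apply]
    · rw [entry_mk π (by omega : (π.symm j : ℕ) + 1 < m + 1), Option.some.inj h]
  · rintro ⟨i, hi, hj, ha⟩
    have e : π.symm j = ⟨i, by omega⟩ := by
      rw [Equiv.symm_apply_eq]
      apply Fin.ext
      rw [← hj, entry_mk π (by omega : i < m + 1)]
    rw [entry_mk π (by omega : i + 1 < m + 1)] at ha
    have hlt : (π.symm j : ℕ) < m := by rw [e]; exact hi
    rw [dif_pos hlt]
    congr 1
    apply Fin.ext
    rw [← ha]
    congr 2
    simp [e]

theorem markedCycle_eq_none_iff {j : Fin (m + 1)} : markedCycle π j = none ↔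
    entry π m = j := by
  unfold markedCycle
  constructor
  · intro h
    split_ifs at h with hlt
    have : π.symm j = Fin.last m := Fin.ext (by rw [Fin.val_last]; omega)
    rw [entry_last, ← this, Equiv.apply_symm_apply]
  · intro h
    rw [entry_last] at h
    have e : π.symm j = Fin.last m := by
      rw [Equiv.symm_apply_eq]
      exact Fin.ext h.symm
    rw [dif_neg]
    simp [e]

end MarkedCycle

section PeriodicWord

variable {r : ℕ}

theorem periodicWord_add_length (d : List (Fin (r + 1))) (i : ℕ) :
    periodicWord d (i + d.length) = periodicWord d i := by
  simp [periodicWord]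

theorem periodicWord_append_self (d : List (Fin (r + 1))) :
    periodicWord (d ++ d) = periodicWord d := by
  funext i
  rcases Nat.eq_zero_or_pos d.length with h | h
  · simp [List.length_eq_zero_iff.mp h]
  have hlen : (d ++ d).length = 2 * d.length := by rw [List.length_append]; omega
  have hmod : i % (2 * d.length) % d.length = i % d.length := Nat.mod_mul_left_mod _ _ _
  have hlt : i % (2 * d.length) < 2 * d.length := Nat.mod_lt _ (by omega)
  unfold periodicWord
  rw [hlen, ← hmod]
  generalize i % (2 * d.length) = k at hlt
  rcases lt_or_ge k d.length with hi | hi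
  · rw [List.getD_append _ _ _ _ hi, Nat.mod_eq_of_lt hi]
  · rw [List.getD_append_right _ _ _ _ hi, Nat.mod_eq_sub_mod hi,
      Nat.mod_eq_of_lt (by omega)]

end PeriodicWord

namespace Segmentation

variable {r m : ℕ} {σ : Signature r} {π : Equiv.Perm (Fin (m + 1))}
  (E : Segmentation σ π) {w : Word r}

theorem p_eq_drop {x : ℕ} (hx : x < m) (hxe : entry π x = entry π m + 1) :
    E.p = (List.ofFn E.assocWord).drop x := by
  rw [entry_mk π (by omega : x < m + 1), entry_last] at hxe
  -- The existence of `x` keeps the last entry below the maximum, so `+ 1` does not wrap around in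
  -- `Fin (m + 1)`.
  have hlt : π (Fin.last m) < Fin.last m := by
    rw [Fin.lt_def, Fin.val_last]
    have := (π ⟨x, by omega⟩).isLt
    omega
  have e : π.symm (π (Fin.last m) + 1) = ⟨x, by omega⟩ := by
    rw [Equiv.symm_apply_eq]
    apply Fin.ext
    rw [Fin.val_add_one_of_lt hlt, hxe]
  rw [p, e]

theorem q_eq_drop {y : ℕ} (hy : y < m) (hye : entry π y + 1 = entry π m) :
    E.q = (List.ofFn E.assocWord).drop y := by
  rw [entry_mk π (by omega : y < m + 1), entry_last] at hye
  have hlt : π ⟨y, by omega⟩ < Fin.last m := by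
    rw [Fin.lt_def, Fin.val_last]
    have := (π (Fin.last m)).isLt
    omega
  have e : π.symm (π (Fin.last m) - 1) = ⟨y, by omega⟩ := by
    rw [Equiv.symm_apply_eq, sub_eq_iff_eq_add]
    apply Fin.ext
    rw [Fin.val_add_one_of_lt hlt, hye]
  rw [q, e]

theorem periodicWord_drop_add (x i : ℕ) :
    periodicWord ((List.ofFn E.assocWord).drop x) (i + (m - x)) =
      periodicWord ((List.ofFn E.assocWord).drop x) i := by
  have h := periodicWord_add_length ((List.ofFn E.assocWord).drop x) i
  rwa [List.length_drop, List.length_ofFn] at h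

theorem periodicWord_drop_apply (hw : ∀ i : Fin m, w i = E.assocWord i) {x i : ℕ}
    (hi : i < m - x) : periodicWord ((List.ofFn E.assocWord).drop x) i = w (x + i) := by
  have h := hw ⟨x + i, by omega⟩
  unfold periodicWord
  rw [List.length_drop, List.length_ofFn, Nat.mod_eq_of_lt hi, List.getD_eq_getElem _ _ (by
    rw [List.length_drop, List.length_ofFn]
    exact hi), List.getElem_drop, List.getElem_ofFn]
  exact h.symm

/-- The tail at `x` is the suffix of the prefix from `x` on, followed by the tail at `m`. Hence
`periodic_compare` trades it for the repetition of that suffix. -/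
theorem compare_drop (hw : ∀ i : Fin m, w i = E.assocWord i) {x : ℕ} (hx : x < m) :
    (Less σ (shift^[m] w) (periodicWord ((List.ofFn E.assocWord).drop x)) ↔
        Less σ (shift^[m] w) (shift^[x] w)) ∧
      (Less σ (periodicWord ((List.ofFn E.assocWord).drop x)) (shift^[m] w) ↔
        Less σ (shift^[x] w) (shift^[m] w)) := by
  refine periodic_compare (Nat.sub_pos_of_lt hx) (E.periodicWord_drop_add x) ?_ ?_
  · intro i hi
    rw [E.periodicWord_drop_apply hw hi, iterate_shift_apply, add_comm x]
  · rw [← Function.iterate_add_apply, Nat.sub_add_cancel hx.le]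

theorem lowerBound_of_eq_zero (h : entry π m = 0) (v : Word r) : E.LowerBound v := by
  rw [entry_last] at h
  rw [LowerBound, if_pos (Fin.ext h)]
  exact minWord_lessEq σ v

theorem upperBound_of_eq_last (h : entry π m = m) (v : Word r) : E.UpperBound v := by
  rw [entry_last] at h
  rw [UpperBound, if_pos (Fin.ext h)]
  exact lessEq_maxWord σ v

theorem lowerBound_iff {y : ℕ} (hy : y < m) (hye : entry π y + 1 = entry π m) (v : Word r) :
    E.LowerBound v ↔ Less σ (periodicWord ((List.ofFn E.assocWord).drop y)) v := by
  rw [LowerBound, if_neg, E.q_eq_drop hy hye]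
  intro h
  rw [entry_last, h, Fin.val_zero] at hye
  omega

theorem upperBound_iff {x : ℕ} (hx : x < m) (hxe : entry π x = entry π m + 1) (v : Word r) :
    E.UpperBound v ↔ Less σ v (periodicWord ((List.ofFn E.assocWord).drop x)) := by
  rw [UpperBound, if_neg, E.p_eq_drop hx hxe]
  intro h
  have := entry_le π x
  rw [hxe, entry_last, h, Fin.val_last] at this
  omega

theorem mem_block (hw : ∀ i : Fin m, w i = E.assocWord i) {i : ℕ} (hi : i < m) :
    E.e (w i).castSucc ≤ entry π i ∧ entry π i < E.e (w i).succ := by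
  have h := (E.existsUnique_block (π (Fin.castSucc ⟨i, hi⟩))).choose_spec.1
  rw [entry_mk π (by omega : i < m + 1), hw ⟨i, hi⟩]
  exact h

theorem follows (hw : ∀ i : Fin m, w i = E.assocWord i) : Follows σ π w := by
  have key : ∀ i j, i < m → j < m → entry π i < entry π j → w i = w j →
      (σ (w i) = 1 → entry π (i + 1) < entry π (j + 1)) ∧
        (σ (w i) = -1 → entry π (j + 1) < entry π (i + 1)) := by
    intro i j hi hj hij he
    have hi1 : i + 1 < m + 1 := by omega
    have hj1 : j + 1 < m + 1 := by omega
    have h1 := (E.mem_block hw hi).1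
    have h2 := (E.mem_block hw hj).2
    rw [← he] at h2
    rw [entry_mk π hi1, entry_mk π hj1]
    rw [entry_mk π (by omega : i < m + 1), entry_mk π (by omega : j < m + 1)] at hij
    rw [entry_mk π (by omega : i < m + 1)] at h1
    rw [entry_mk π (by omega : j < m + 1)] at h2
    exact E.block (w i) _ _ _ _ h1 hij h2
      (markedCycle_eq_some_iff.mpr ⟨i, hi, entry_mk π _, entry_mk π hi1⟩)
      (markedCycle_eq_some_iff.mpr ⟨j, hj, entry_mk π _, entry_mk π hj1⟩)
  refine ⟨?_, fun i j hi hj hij he => (key i j hi hj hij he).1,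
    fun i j hi hj hij he => (key i j hi hj hij he).2⟩
  intro i j hi hj hij
  by_contra hlt
  have h1 := (E.mem_block hw hi).1
  have h2 := (E.mem_block hw hj).2
  have := E.e_mono (show (w j).succ ≤ (w i).castSucc from not_le.mp hlt)
  omega

/-- By `compare_drop` the bounds say that the tail at `m` lies between the tails at the two
neighbours, which is all that `Follows.hasPattern` asks for. At an extreme entry the bound on that
side always holds. -/
theorem hasPattern_iff_bounds (hw : ∀ i : Fin m, w i = E.assocWord i) :
    HasPattern (Less σ) shift w π ↔
      E.LowerBound (shift^[m] w) ∧ E.UpperBound (shift^[m] w) := by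
  constructor
  · intro h
    rw [hasPattern_iff] at h
    constructor
    · by_cases h0 : entry π m = 0
      · exact E.lowerBound_of_eq_zero h0 _
      · obtain ⟨y, hym, hye⟩ := exists_entry_eq π (c := entry π m - 1) (by
          have := entry_le π m
          omega)
        have hy : y < m := lt_of_le_of_ne hym (by rintro rfl; omega)
        rw [E.lowerBound_iff hy (by omega), (E.compare_drop hw hy).2]
        exact h _ _ hym le_rfl (by omega)
    · by_cases h0 : entry π m = m
      · exact E.upperBound_of_eq_last h0 _
      · obtain ⟨x, hxm, hxe⟩ := exists_entry_eq π (c := entry π m + 1) (by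
          have := entry_le π m
          omega)
        have hx : x < m := lt_of_le_of_ne hxm (by rintro rfl; omega)
        rw [E.upperBound_iff hx hxe, (E.compare_drop hw hx).1]
        exact h _ _ le_rfl hxm (by omega)
  · rintro ⟨hl, hu⟩
    refine (E.follows hw).hasPattern (fun x hx hxe => ?_) fun y hy hye => ?_
    · rwa [E.upperBound_iff hx hxe, (E.compare_drop hw hx).1] at hu
    · rwa [E.lowerBound_iff hy hye, (E.compare_drop hw hy).2] at hl

theorem valid_of_bounds {v : Word r} (hl : E.LowerBound v) (hu : E.UpperBound v) : E.Valid := by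
  rintro ⟨h0, hm, h⟩
  rw [LowerBound, if_neg h0] at hl
  rw [UpperBound, if_neg hm] at hu
  have he : periodicWord E.q = periodicWord E.p := by
    rcases h with h | h <;> rw [h, periodicWord_append_self]
  rw [he] at hl
  exact hl.asymm hu

/-- A segmentation is determined by its associated word. -/
theorem assocWord_injective :
    Function.Injective (assocWord : Segmentation σ π → Fin m → Fin (r + 1)) := by
  have key : ∀ E F : Segmentation σ π, E.assocWord = F.assocWord → ∀ t, E.e t ≤ F.e t := by
    intro E F h t
    by_contra hlt
    rw [not_le] at hlt
    have hle : E.e t ≤ m + 1 := E.e_last ▸ E.e_mono (Fin.le_last t)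
    -- A position in the gap has a label below `t` for `E` and at least `t` for `F`. Since the
    -- prefixes agree, it must be the star, so the gap has length one and `E.e t` comes right after
    -- the star, contrary to `ne_star`.
    have inner : ∀ j, F.e t ≤ j → j < E.e t → j = entry π m := by
      intro j h1 h2
      obtain ⟨i, him, rfl⟩ := exists_entry_eq π (c := j) (by omega)
      rcases Nat.lt_or_eq_of_le him with hi | rfl
      swap
      · rfl
      exfalso
      let w : Word r := appendWord E.assocWord (constWord 0)
      have hw : ∀ i : Fin m, w i = E.assocWord i := fun i => appendWord_apply_of_lt _ _ i.isLt
      have hE := (E.mem_block hw hi).1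
      have hF := (F.mem_block (fun i => h ▸ hw i) hi).2
      rcases lt_or_ge (w i).castSucc t with hc | hc
      · have := F.e_mono (show (w i).succ ≤ t from Fin.castSucc_lt_iff_succ_le.mp hc)
        omega
      · have := E.e_mono hc
        omega
    have h1 := inner _ le_rfl hlt
    have h2 : E.e t = entry π m + 1 := by
      by_contra hne
      have := inner (F.e t + 1) (by omega) (by omega)
      omega
    rw [entry_last] at h2
    refine E.ne_star t ?_ ?_ h2
    · rintro rfl
      rw [E.e_zero] at hlt
      omega
    · rintro rfl
      rw [E.e_last, F.e_last] at hlt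
      omega
  intro E F h
  have he : E.e = F.e := funext fun t => le_antisymm (key E F h t) (key F E h.symm t)
  cases E
  cases F
  cases he
  rfl

theorem finite_segmentation : Finite (Segmentation σ π) :=
  Finite.of_injective _ assocWord_injective

end Segmentation

end SignedShift

/-! ### From a word to a segmentation -/

namespace SignedShift

section ExtremeWords

variable {r : ℕ} {σ : Signature r}

theorem not_less_minWord (v : Word r) : ¬ Less σ v (minWord σ) :=
  not_less.mpr (minWord_lessEq σ v)

theorem not_maxWord_less (v : Word r) : ¬ Less σ (maxWord σ) v :=
  not_less.mpr (lessEq_maxWord σ v)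

theorem minWord_add_one (h : σ 0 = 1) (i : ℕ) : minWord σ (i + 1) = minWord σ i :=
  congrFun (shift_minWord_plus σ h) i

theorem maxWord_add_one (h : σ (Fin.last r) = 1) (i : ℕ) : maxWord σ (i + 1) = maxWord σ i :=
  congrFun (shift_maxWord_plus σ h) i

theorem minWord_one (h : σ 0 = -1) : minWord σ 1 = Fin.last r := by
  have := congrFun (shift_minWord_minus σ (by rw [h]; exact units_neg_one_ne_one)) 0
  rw [maxWord_zero] at this
  exact this

theorem maxWord_one (h : σ (Fin.last r) = -1) : maxWord σ 1 = 0 := by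
  have := congrFun (shift_maxWord_minus σ (by rw [h]; exact units_neg_one_ne_one)) 0
  rw [minWord_zero] at this
  exact this

theorem minWord_add_two (h : σ 0 = -1) (h' : σ (Fin.last r) = -1) (i : ℕ) :
    minWord σ (i + 2) = minWord σ i := by
  have h1 := congrFun (shift_minWord_minus σ (by rw [h]; exact units_neg_one_ne_one)) (i + 1)
  have h2 := congrFun (shift_maxWord_minus σ (by rw [h']; exact units_neg_one_ne_one)) i
  exact h1.trans h2

theorem maxWord_add_two (h : σ 0 = -1) (h' : σ (Fin.last r) = -1) (i : ℕ) :
    maxWord σ (i + 2) = maxWord σ i := by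
  have h1 := congrFun (shift_maxWord_minus σ (by rw [h']; exact units_neg_one_ne_one)) (i + 1)
  have h2 := congrFun (shift_minWord_minus σ (by rw [h]; exact units_neg_one_ne_one)) i
  exact h1.trans h2

/-- If the tail of `w` at `m` is smaller than the tail at `j`, then it is smaller than the
repetition of the factor between them. -/
theorem less_of_repetition {j m : ℕ} (hj : j < m) {c w : Word r}
    (hc : ∀ i, c (i + (m - j)) = c i) (hw : ∀ i < m - j, w (j + i) = c i) :
    (Less σ (shift^[m] w) (shift^[j] w) → Less σ (shift^[m] w) c) ∧
      (Less σ (shift^[j] w) (shift^[m] w) → Less σ c (shift^[m] w)) := by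
  have h := periodic_compare (σ := σ) (Nat.sub_pos_of_lt hj) (u := shift^[j] w)
    (v := shift^[m] w) hc (fun i hi => by rw [iterate_shift_apply, add_comm i, hw i hi])
    (by rw [← Function.iterate_add_apply, Nat.sub_add_cancel hj.le])
  exact ⟨h.1.mpr, h.2.mpr⟩

end ExtremeWords

section Counting

/-- For a monotone labelling of `Fin n`, the number of positions with a label below `t` bounds
exactly these positions. -/
theorem lt_card_filter_iff {n k : ℕ} {L : Fin n → Fin k} (hL : Monotone L) (t : ℕ) (j : Fin n) :
    (j : ℕ) < (Finset.univ.filter fun i => (L i : ℕ) < t).card ↔ (L j : ℕ) < t := by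
  constructor
  · intro h
    by_contra hlt
    have hsub : (Finset.univ.filter fun i => (L i : ℕ) < t) ⊆ Finset.Iio j := by
      intro i hi
      rw [Finset.mem_filter] at hi
      rw [Finset.mem_Iio]
      by_contra hij
      have : (L j : ℕ) ≤ L i := hL (not_lt.mp hij)
      omega
    have := Finset.card_le_card hsub
    rw [Fin.card_Iio] at this
    omega
  · intro h
    have hsub : Finset.Iic j ⊆ (Finset.univ.filter fun i => (L i : ℕ) < t) := by
      intro i hi
      rw [Finset.mem_Iic] at hi
      rw [Finset.mem_filter]
      have : (L i : ℕ) ≤ L j := hL hi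
      exact ⟨Finset.mem_univ _, by omega⟩
    have := Finset.card_le_card hsub
    rw [Fin.card_Iic] at this
    omega

end Counting

section Existence

variable {r m : ℕ} {σ : Signature r} {π : Equiv.Perm (Fin (m + 1))} {w : Word r}

/-- The prefix of a word that follows `π` extends to a monotone labelling of all positions, for
which the star has the label of the next position, or the largest label if there is none. -/
theorem Follows.exists_labelling (h : Follows σ π w) :
    ∃ L : Fin (m + 1) → Fin (r + 1), Monotone L ∧
      (∀ i < m, ∀ j : Fin (m + 1), entry π i = j → L j = w i) ∧
      (∀ x < m, entry π x = entry π m + 1 → ∀ j : Fin (m + 1), entry π m = j → L j = w x) ∧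
      (entry π m = m → L (Fin.last m) = Fin.last r) := by
  classical
  let L : Fin (m + 1) → Fin (r + 1) := fun j =>
    if (π.symm j : ℕ) < m then w (π.symm j)
    else if j = Fin.last m then Fin.last r else w (π.symm (j + 1))
  have symm_eq : ∀ i ≤ m, ∀ j : Fin (m + 1), entry π i = j → (π.symm j : ℕ) = i := by
    intro i hi j hij
    refine entry_inj (π := π) (Nat.lt_succ_iff.mp (Fin.isLt _)) hi ?_
    rw [entry_fin, Equiv.apply_symm_apply, hij]
  have h1 : ∀ i < m, ∀ j : Fin (m + 1), entry π i = j → L j = w i := by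
    intro i hi j hij
    have := symm_eq i hi.le j hij
    simp only [L]
    rw [this, if_pos hi]
  have h2 : ∀ x < m, entry π x = entry π m + 1 → ∀ j : Fin (m + 1), entry π m = j →
      L j = w x := by
    intro x hx hxe j hj
    have hlt : j < Fin.last m := by
      rw [Fin.lt_def, Fin.val_last]
      have := entry_le π x
      omega
    have e := symm_eq x hx.le (j + 1) (by rw [Fin.val_add_one_of_lt hlt]; omega)
    have := symm_eq m le_rfl j hj
    simp only [L]
    rw [this, if_neg (lt_irrefl _), if_neg hlt.ne, e]
  have h3 : entry π m = m → L (Fin.last m) = Fin.last r := by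
    intro hm
    have := symm_eq m le_rfl (Fin.last m) hm
    simp only [L]
    rw [this, if_neg (lt_irrefl _)]
    exact if_pos trivial
  refine ⟨L, ?_, h1, h2, h3⟩
  intro i j hij
  rcases eq_or_lt_of_le hij with rfl | hij
  · exact le_rfl
  obtain ⟨a, ham, ha⟩ := exists_entry_eq π (Nat.lt_succ_iff.mp i.isLt)
  obtain ⟨b, hbm, hb⟩ := exists_entry_eq π (Nat.lt_succ_iff.mp j.isLt)
  have hab : entry π a < entry π b := by
    rw [ha, hb]
    exact hij
  rcases Nat.lt_or_eq_of_le ham with ham' | rfl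
  · rw [h1 a ham' i ha]
    rcases Nat.lt_or_eq_of_le hbm with hbm' | rfl
    · rw [h1 b hbm' j hb]
      exact h.le a b ham' hbm' hab
    · by_cases hlast : entry π b = b
      · have : j = Fin.last b := Fin.ext (by rw [← hb, hlast, Fin.val_last])
        rw [this, h3 hlast]
        exact Fin.le_last _
      · obtain ⟨x, hxm, hxe⟩ := exists_entry_eq π (c := entry π b + 1) (by
          have := entry_le π b
          omega)
        have hx : x < b := lt_of_le_of_ne hxm (by rintro rfl; omega)
        rw [h2 x hx hxe j hb]
        exact h.le a x ham' hx (by omega)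
  · have hb' : b < a := lt_of_le_of_ne hbm (by rintro rfl; omega)
    obtain ⟨x, hxm, hxe⟩ := exists_entry_eq π (c := entry π a + 1) (by
      have := entry_le π b
      omega)
    have hx : x < a := lt_of_le_of_ne hxm (by rintro rfl; omega)
    rw [h2 x hx hxe i ha, h1 b hb' j hb]
    by_cases he : entry π x = entry π b
    · rw [entry_inj hxm hbm he]
    · exact h.le x b hx hb' (by omega)

/-- The index `e t` counts the positions with a label below `t`. In each of the special cases (b) to
(e), a failure would make the last one or two letters of the prefix a period of an extreme word, and
push the tail at `m` strictly beyond that word. -/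
theorem exists_segmentation (h : HasPattern (Less σ) shift w π) :
    ∃ E : Segmentation σ π, ∀ i : Fin m, w i = E.assocWord i := by
  classical
  have hf := follows_of_hasPattern h
  rw [hasPattern_iff] at h
  obtain ⟨L, hmono, hL, hstar, hlast⟩ := hf.exists_labelling
  let e : Fin (r + 2) → ℕ := fun t => (Finset.univ.filter fun i => (L i : ℕ) < t).card
  have he : ∀ (t : Fin (r + 2)) (j : Fin (m + 1)), (j : ℕ) < e t ↔ (L j : ℕ) < t :=
    fun t j => lt_card_filter_iff hmono t j
  have hle : ∀ t, e t ≤ m + 1 := fun t => (Finset.card_le_univ _).trans (Fintype.card_fin _).le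
  have val_one : ((1 : Fin (r + 2)) : ℕ) = 1 := rfl
  have e_one : L 0 ≠ 0 → e 1 = 0 := by
    intro h0
    by_contra hne
    have := (he 1 0).mp (Nat.pos_of_ne_zero hne)
    rw [val_one] at this
    exact h0 (Fin.ext (by rw [Fin.val_zero]; omega))
  have hblock : ∀ (t : Fin (r + 1)) (j : Fin (m + 1)), e t.castSucc ≤ j → (j : ℕ) < e t.succ →
      L j = t := by
    intro t j h1 h2
    rw [← not_lt, he, Fin.val_castSucc] at h1
    rw [he, Fin.val_succ] at h2
    exact Fin.ext (by omega)
  -- If the letters from `j` to `m - 1` form a period of the smallest word, a tail at `m` below the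
  -- tail at `j` would be smaller than the smallest word.
  have min_false : ∀ j < m, ∀ L' : ℕ, 0 < L' → m - j = L' → entry π m < entry π j →
      (∀ i, minWord σ (i + L') = minWord σ i) → (∀ i < L', w (j + i) = minWord σ i) → False := by
    rintro j hj _ - rfl hlt hc hw
    exact not_less_minWord _ ((less_of_repetition hj hc hw).1 (h _ _ le_rfl hj.le hlt))
  have max_false : ∀ j < m, ∀ L' : ℕ, 0 < L' → m - j = L' → entry π j < entry π m →
      (∀ i, maxWord σ (i + L') = maxWord σ i) → (∀ i < L', w (j + i) = maxWord σ i) → False := by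
    rintro j hj _ - rfl hlt hc hw
    exact not_maxWord_less _ ((less_of_repetition hj hc hw).2 (h _ _ hj.le le_rfl hlt))
  have fin_one : ∀ i < m, ((1 : Fin (m + 1)) : ℕ) = 1 := fun i hi => by
    rw [Fin.val_one', Nat.mod_eq_of_lt (by omega)]
  have fin_pred : ∀ i < m, ((Fin.last m - 1 : Fin (m + 1)) : ℕ) = m - 1 := fun i hi => by
    rw [Fin.val_sub_one_of_ne_zero, Fin.val_last]
    intro h0
    have := congrArg Fin.val h0
    rw [Fin.val_last, Fin.val_zero] at this
    omega
  have e_castSucc_last : ∀ c ≤ m + 1, (∀ j : Fin (m + 1), (j : ℕ) < c → L j ≠ Fin.last r) →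
      (∀ j : Fin (m + 1), c ≤ j → L j = Fin.last r) → e (Fin.last r).castSucc = c := by
    intro c hc h1 h2
    refine le_antisymm ?_ ?_
    · by_contra hlt
      have hc' : c < m + 1 := lt_of_lt_of_le (not_le.mp hlt) (hle _)
      have := (he (Fin.last r).castSucc ⟨c, hc'⟩).mp (not_le.mp hlt)
      rw [h2 ⟨c, hc'⟩ le_rfl] at this
      exact lt_irrefl _ this
    · rcases Nat.eq_zero_or_pos c with rfl | hpos
      · exact Nat.zero_le _
      · have hlt : (L ⟨c - 1, by omega⟩ : ℕ) < r := by
          have := h1 ⟨c - 1, by omega⟩ (by simp only; omega)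
          have := Fin.val_lt_last this
          omega
        have := (he (Fin.last r).castSucc ⟨c - 1, by omega⟩).mpr hlt
        simp only at this
        omega
  let E : Segmentation σ π :=
    { e := e
      e_zero := by simp [e]
      e_mono := by
        intro s t hst
        refine Finset.card_le_card fun i hi => ?_
        rw [Finset.mem_filter] at hi ⊢
        exact ⟨hi.1, lt_of_lt_of_le hi.2 hst⟩
      e_last := by
        refine le_antisymm (hle _) ?_
        exact (he _ (Fin.last m)).mpr (by
          have := (L (Fin.last m)).isLt
          rw [Fin.val_last]
          omega)
      block := by
        intro t i j a b h1 hij h2 hi hj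
        obtain ⟨x, hx, hxi, hxa⟩ := markedCycle_eq_some_iff.mp hi
        obtain ⟨y, hy, hyj, hyb⟩ := markedCycle_eq_some_iff.mp hj
        have hij' : (i : ℕ) < j := hij
        have ex := hblock t i h1 (by omega)
        have ey := hblock t j (by omega) h2
        rw [hL x hx i hxi] at ex
        rw [hL y hy j hyj] at ey
        rw [Fin.lt_def, Fin.lt_def, ← hxa, ← hyb, ← ex]
        exact ⟨hf.plus x y hx hy (by omega) (ex.trans ey.symm),
          hf.minus x y hx hy (by omega) (ex.trans ey.symm)⟩
      start_plus := by
        intro hs h0 h1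
        rw [markedCycle_eq_none_iff, Fin.val_zero] at h0
        obtain ⟨i, hi, hi1, hi0⟩ := markedCycle_eq_some_iff.mp h1
        rw [fin_one i hi] at hi1
        rw [Fin.val_zero, ← h0] at hi0
        have him : i + 1 = m := entry_inj hi le_rfl hi0
        -- The star is at position `0` and has the label of position `1`, which is the letter `w (m
        -- - 1)`. If it is `0`, that single letter is a period of the smallest word.
        refine e_one fun hL0 => ?_
        rw [hstar i hi (by omega) 0 h0] at hL0
        refine min_false i hi 1 one_pos (by omega) (by omega) (minWord_add_one hs) ?_
        intro k hk
        obtain rfl : k = 0 := by omega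
        rw [minWord_zero]
        exact hL0
      end_plus := by
        intro hs h1 h0
        rw [markedCycle_eq_none_iff, Fin.val_last] at h0
        obtain ⟨i, hi, hi1, hi0⟩ := markedCycle_eq_some_iff.mp h1
        rw [Fin.val_last] at hi0
        have him : i + 1 = m := entry_inj hi le_rfl (hi0.trans h0.symm)
        have hLi := hL i hi _ hi1
        have hne : w i ≠ Fin.last r := by
          intro hw
          refine max_false i hi 1 one_pos (by omega) ?_ (maxWord_add_one hs) ?_
          · rw [fin_pred i hi] at hi1
            omega
          intro k hk
          obtain rfl : k = 0 := by omega
          rw [maxWord_zero]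
          exact hw
        refine e_castSucc_last m (by omega) ?_ ?_
        · intro j hj hLj
          have := hmono (show j ≤ Fin.last m - 1 by
            rw [Fin.le_def, fin_pred i hi]
            omega)
          rw [hLj, hLi] at this
          exact hne (Fin.last_le_iff.mp this)
        · intro j hj
          have : j = Fin.last m := Fin.ext (by rw [Fin.val_last]; omega)
          rw [this, hlast h0]
      minus_end := by
        intro hs0 hsr h0 h1 h2
        rw [markedCycle_eq_none_iff, Fin.val_last] at h2
        obtain ⟨i, hi, hi1, hi0⟩ := markedCycle_eq_some_iff.mp h0
        obtain ⟨j, hj, hj1, hj0⟩ := markedCycle_eq_some_iff.mp h1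
        rw [Fin.val_last] at hi0
        rw [Fin.val_zero] at hi1 hj0
        have him : i + 1 = m := entry_inj hi le_rfl (hi0.trans h2.symm)
        have hji : j + 1 = i := entry_inj hj (by omega) (hj0.trans hi1.symm)
        -- If both alternatives failed, the prefix would end with the last letter followed by `0`, a
        -- period of the largest word.
        by_cases hL0 : L 0 = 0
        swap
        · exact Or.inl (e_one hL0)
        right
        have hLj := hL j hj _ hj1
        rw [hL i hi 0 hi1] at hL0
        have hne : w j ≠ Fin.last r := by
          intro hw
          refine max_false j hj 2 two_pos (by omega) ?_ (maxWord_add_two hs0 hsr) ?_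
          · rw [fin_pred i hi] at hj1
            omega
          intro k hk
          obtain rfl | rfl : k = 0 ∨ k = 1 := by omega
          · rw [maxWord_zero]
            exact hw
          · rw [maxWord_one hsr, hji, hL0]
        refine e_castSucc_last m (by omega) ?_ ?_
        · intro k hk hLk
          have := hmono (show k ≤ Fin.last m - 1 by
            rw [Fin.le_def, fin_pred i hi]
            omega)
          rw [hLk, hLj] at this
          exact hne (Fin.last_le_iff.mp this)
        · intro k hk
          have : k = Fin.last m := Fin.ext (by rw [Fin.val_last]; omega)
          rw [this, hlast h2]
      minus_start := by
        intro hs0 hsr h0 h1 h2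
        rw [markedCycle_eq_none_iff, Fin.val_zero] at h0
        obtain ⟨j, hj, hj1, hj0⟩ := markedCycle_eq_some_iff.mp h1
        obtain ⟨i, hi, hi1, hi0⟩ := markedCycle_eq_some_iff.mp h2
        rw [Fin.val_zero, ← h0] at hi0
        rw [Fin.val_last] at hi1 hj0
        rw [fin_one j hj] at hj1
        have him : i + 1 = m := entry_inj hi le_rfl hi0
        have hji : j + 1 = i := entry_inj hj (by omega) (hj0.trans hi1.symm)
        by_cases hL0 : L 0 = 0
        swap
        · exact Or.inl (e_one hL0)
        right
        rw [hstar j hj (by omega) 0 h0] at hL0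
        have hLi := hL i hi (Fin.last m) hi1
        have hne : w i ≠ Fin.last r := by
          intro hw
          refine min_false j hj 2 two_pos (by omega) (by omega) (minWord_add_two hs0 hsr) ?_
          intro k hk
          obtain rfl | rfl : k = 0 ∨ k = 1 := by omega
          · rw [minWord_zero]
            exact hL0
          · rw [minWord_one hs0, hji, hw]
        refine e_castSucc_last (m + 1) le_rfl ?_ ?_
        · intro k hk hLk
          have := hmono (Fin.le_last k)
          rw [hLk, hLi] at this
          exact hne (Fin.last_le_iff.mp this)
        · intro k hk
          omega
      ne_star := by
        intro t ht0 htl het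
        -- An index right after the star would separate it from the next position, but both have the
        -- same label. A star in the last position has the label `r`, so no inner index counts it.
        have htr : (t : ℕ) < r + 1 := Fin.val_lt_last htl
        rw [← entry_last] at het
        have hc := (he t ⟨entry π m, Nat.lt_succ_of_le (entry_le π m)⟩).mp (by
          simp only
          omega)
        by_cases hm : entry π m = m
        · have : (⟨entry π m, Nat.lt_succ_of_le (entry_le π m)⟩ : Fin (m + 1)) = Fin.last m :=
            Fin.ext hm
          rw [this, hlast hm, Fin.val_last] at hc
          omega
        · have hlt : entry π m + 1 ≤ m := by
            have := entry_le π m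
            omega
          obtain ⟨x, hxm, hxe⟩ := exists_entry_eq π hlt
          have hx : x < m := lt_of_le_of_ne hxm (by rintro rfl; omega)
          rw [hstar x hx hxe ⟨entry π m, _⟩ rfl, ← hL x hx ⟨entry π m + 1, by omega⟩ hxe,
            ← he] at hc
          simp only at hc
          omega }
  refine ⟨E, fun i => ?_⟩
  have hi := (E.existsUnique_block (π i.castSucc)).choose_spec.1
  have := hblock (E.assocWord i) (π i.castSucc) hi.1 hi.2
  rw [← this]
  exact (hL i i.isLt _ (entry_fin π i.castSucc)).symm

end Existence

end SignedShift

/-! ### Separating `q^∞` from `p^∞` -/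

namespace SignedShift

section Sequences

/-- A word with two periods has their greatest common divisor as a period. -/
theorem periodic_gcd {α : Type*} {f : ℕ → α} {a b : ℕ} (ha : Function.Periodic f a)
    (hb : Function.Periodic f b) : Function.Periodic f (a.gcd b) := by
  induction a, b using Nat.gcd.induction with
  | H0 n => rwa [Nat.gcd_zero_left]
  | H1 m n _ ih =>
    rw [Nat.gcd_rec]
    refine ih (fun i => ?_) ha
    have h := ha.nsmul (n / m) (i + n % m)
    rw [← h, smul_eq_mul, add_assoc, mul_comm, Nat.mod_add_div, hb]

/-- If the shift of a sequence of distinct integers preserves the order, then the first term does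
not lie between two other terms. -/
theorem no_neighbours_of_increasing {s : ℕ → ℤ} {M a b : ℕ}
    (hinj : ∀ c d, c ≤ M → d ≤ M → s c = s d → c = d) (ha : a ≤ M) (hb : b ≤ M) (hb0 : 0 < b)
    (h : ∀ c d, c < M → d < M → s (c + 1) < s (d + 1) → s c < s d) (hsa : s 0 < s a)
    (hsb : s b < s 0) : False := by
  have h' : ∀ c d, c < M → d < M → s c < s d → s (c + 1) < s (d + 1) := by
    intro c d hc hd hlt
    by_contra hcon
    rcases eq_or_lt_of_le (not_lt.mp hcon) with he | hl
    · have := hinj _ _ (by omega) (by omega) he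
      obtain rfl : c = d := by omega
      omega
    · have := h d c hd hc hl
      omega
  have h01 : s 0 ≠ s 1 := fun he => by
    have := hinj 0 1 (by omega) (by omega) he
    omega
  rcases lt_or_gt_of_ne h01 with h1 | h1
  -- Every later step repeats the direction of the first one, so all later terms lie on the same
  -- side of `s 0`.
  · have : ∀ c, c + 1 ≤ M → s c < s (c + 1) ∧ s 0 < s (c + 1) := by
      intro c
      induction c with
      | zero => exact fun _ => ⟨h1, h1⟩
      | succ c ih =>
        intro hc
        obtain ⟨i1, i2⟩ := ih (by omega)
        have := h' _ _ (by omega) (by omega) i1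
        exact ⟨this, i2.trans this⟩
    obtain ⟨b, rfl⟩ : ∃ c, b = c + 1 := ⟨b - 1, by omega⟩
    have := (this b hb).2
    omega
  · have : ∀ c, c + 1 ≤ M → s (c + 1) < s c ∧ s (c + 1) < s 0 := by
      intro c
      induction c with
      | zero => exact fun _ => ⟨h1, h1⟩
      | succ c ih =>
        intro hc
        obtain ⟨i1, i2⟩ := ih (by omega)
        have := h' _ _ (by omega) (by omega) i1
        exact ⟨this, this.trans i2⟩
    obtain ⟨a, rfl⟩ : ∃ c, a = c + 1 := ⟨a - 1, by
      rcases Nat.eq_zero_or_pos a with rfl | h0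
      · omega
      · omega⟩
    have := (this a ha).2
    omega

/-- If the shift of a sequence of distinct integers reverses the order, and the first step is
upwards, then the neighbours of the first value can only appear as the next two terms. -/
theorem neighbours_of_decreasing_of_lt {s : ℕ → ℤ} {M a b : ℕ}
    (hinj : ∀ c d, c ≤ M → d ≤ M → s c = s d → c = d) (ha : a ≤ M) (hb : b ≤ M) (hb0 : 0 < b)
    (h : ∀ c d, c < M → d < M → s (c + 1) < s (d + 1) → s d < s c) (hsa : s a = s 0 + 1)
    (hsb : s b = s 0 - 1) (h01 : s 0 < s 1) : a = 1 ∧ b = 2 := by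
  have h' : ∀ c d, c < M → d < M → s c < s d → s (d + 1) < s (c + 1) := by
    intro c d hc hd hlt
    by_contra hcon
    rcases eq_or_lt_of_le (not_lt.mp hcon) with he | hl
    · have := hinj _ _ (by omega) (by omega) he
      obtain rfl : c = d := by omega
      omega
    · have := h c d hc hd hl
      omega
  have hb1 : b ≠ 1 := by
    rintro rfl
    omega
  have hM : 2 ≤ M := by omega
  have adj : ∀ k, 2 * k + 1 ≤ M → s (2 * k) < s (2 * k + 1) := by
    intro k
    induction k with
    | zero => exact fun _ => h01
    | succ k ih =>
      intro hk
      have h1 := h' (2 * k) (2 * k + 1) (by omega) (by omega) (ih (by omega))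
      exact h' (2 * k + 1 + 1) (2 * k + 1) (by omega) (by omega) h1
  have h02 : s 0 ≠ s 2 := fun he => by
    have := hinj 0 2 (by omega) (by omega) he
    omega
  -- If `s 0 < s 2`, the even terms increase and each odd term exceeds the even term before it, so
  -- nothing lies below `s 0`.
  rcases lt_or_gt_of_ne h02 with h2 | h2
  · exfalso
    have up : ∀ k, 2 * k + 2 ≤ M → s (2 * k) < s (2 * k + 2) := by
      intro k
      induction k with
      | zero => exact fun _ => h2
      | succ k ih =>
        intro hk
        have h1 := h' (2 * k) (2 * k + 2) (by omega) (by omega) (ih (by omega))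
        exact h' (2 * k + 2 + 1) (2 * k + 1) (by omega) (by omega) h1
    have low : ∀ k, 2 * k ≤ M → s 0 ≤ s (2 * k) := by
      intro k
      induction k with
      | zero => exact fun _ => le_rfl
      | succ k ih => exact fun hk => (ih (by omega)).trans (up k hk).le
    obtain ⟨k, rfl | rfl⟩ := Nat.even_or_odd' b
    · have := low k hb
      omega
    · have h1 := low k (by omega)
      have h3 := adj k hb
      omega
  -- Otherwise the sequence spirals outwards: even terms decrease, odd terms increase, and the terms
  -- closest to `s 0` on either side are `s 1` and `s 2`.
  · have down : ∀ k, 2 * k + 2 ≤ M → s (2 * k + 2) < s (2 * k) ∧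
        (2 * k + 3 ≤ M → s (2 * k + 1) < s (2 * k + 3)) := by
      intro k
      induction k with
      | zero => exact fun _ => ⟨h2, fun hk => h' _ _ (by omega) (by omega) h2⟩
      | succ k ih =>
        intro hk
        have h1 := (ih (by omega)).2 (by omega)
        have h3 := h' _ _ (by omega) (by omega) h1
        exact ⟨h3, fun hk' => h' _ _ (by omega) (by omega) h3⟩
    have even_le : ∀ k, 2 * k + 2 ≤ M → s (2 * k + 2) ≤ s 2 := by
      intro k
      induction k with
      | zero => exact fun _ => le_rfl
      | succ k ih => exact fun hk => (down (k + 1) hk).1.le.trans (ih (by omega))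
    have odd_ge : ∀ k, 2 * k + 1 ≤ M → s 1 ≤ s (2 * k + 1) := by
      intro k
      induction k with
      | zero => exact fun _ => le_rfl
      | succ k ih => exact fun hk => (ih (by omega)).trans ((down k (by omega)).2 hk).le
    constructor
    · obtain ⟨k, rfl | rfl⟩ := Nat.even_or_odd' a
      · rcases k with _ | k
        · simp at hsa
        · have := even_le k ha
          rw [show 2 * (k + 1) = 2 * k + 2 by ring] at hsa
          omega
      · have := odd_ge k ha
        exact hinj _ _ ha (by omega) (by omega)
    · obtain ⟨k, rfl | rfl⟩ := Nat.even_or_odd' b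
      · rcases k with _ | k
        · omega
        · have := even_le k hb
          rw [show 2 * (k + 1) = 2 * k + 2 by ring] at hsb ⊢
          exact hinj _ _ hb (by omega) (by omega)
      · have := odd_ge k hb
        omega

theorem neighbours_of_decreasing {s : ℕ → ℤ} {M a b : ℕ}
    (hinj : ∀ c d, c ≤ M → d ≤ M → s c = s d → c = d) (ha : a ≤ M) (hb : b ≤ M) (ha0 : 0 < a)
    (hb0 : 0 < b) (h : ∀ c d, c < M → d < M → s (c + 1) < s (d + 1) → s d < s c)
    (hsa : s a = s 0 + 1) (hsb : s b = s 0 - 1) : (a = 1 ∧ b = 2) ∨ (b = 1 ∧ a = 2) := by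
  have h01 : s 0 ≠ s 1 := fun he => by
    have := hinj 0 1 (by omega) (by omega) he
    omega
  rcases lt_or_gt_of_ne h01 with h1 | h1
  · exact Or.inl (neighbours_of_decreasing_of_lt hinj ha hb hb0 h hsa hsb h1)
  · refine Or.inr (neighbours_of_decreasing_of_lt (s := fun c => -s c) (M := M) ?_ hb ha ha0 ?_
      ?_ ?_ ?_)
    · exact fun c d hc hd he => hinj c d hc hd (neg_injective he)
    · exact fun c d hc hd hlt => neg_lt_neg (h d c hd hc (neg_lt_neg_iff.mp hlt))
    · omega
    · omega
    · omega

theorem eq_of_periodicWord_eq {r : ℕ} {d d' : List (Fin (r + 1))} (hlen : d.length = d'.length)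
    (h : periodicWord d = periodicWord d') : d = d' := by
  refine List.ext_getElem hlen fun i h1 h2 => ?_
  have := congrFun h i
  unfold periodicWord at this
  rwa [Nat.mod_eq_of_lt h1, Nat.mod_eq_of_lt h2, List.getD_eq_getElem _ _ h1,
    List.getD_eq_getElem _ _ h2] at this

end Sequences

variable {r m : ℕ} {σ : Signature r} {π : Equiv.Perm (Fin (m + 1))} {w : Word r}

/-- Equal factors preserve or reverse the order of the entries, according to their sign. -/
theorem Follows.of_factor (h : Follows σ π w) {u : Word r} {i j l : ℕ} (hi : i + l ≤ m)
    (hj : j + l ≤ m) (hwi : ∀ t < l, w (i + t) = u t) (hwj : ∀ t < l, w (j + t) = u t)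
    (hij : entry π i < entry π j) :
    (prefixSign σ u l = 1 → entry π (i + l) < entry π (j + l)) ∧
      (prefixSign σ u l = -1 → entry π (j + l) < entry π (i + l)) := by
  induction l with
  | zero =>
    refine ⟨fun _ => hij, fun h => ?_⟩
    simp [prefixSign] at h
  | succ l ih =>
    have ih := ih (by omega) (by omega) (fun t ht => hwi t (by omega))
      fun t ht => hwj t (by omega)
    have ei := hwi l (by omega)
    have ej := hwj l (by omega)
    have e : prefixSign σ u (l + 1) = prefixSign σ u l * σ (u l) := Finset.prod_range_succ _ _
    rw [e]
    rcases Int.units_eq_one_or (prefixSign σ u l) with h1 | h1 <;>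
      rcases Int.units_eq_one_or (σ (u l)) with h2 | h2
    · have h3 := h.plus _ _ (by omega) (by omega) (ih.1 h1) (ei.trans ej.symm) (ei ▸ h2)
      rw [h1, h2]
      exact ⟨fun _ => h3, fun h => absurd h.symm units_neg_one_ne_one⟩
    · have h3 := h.minus _ _ (by omega) (by omega) (ih.1 h1) (ei.trans ej.symm) (ei ▸ h2)
      rw [h1, h2]
      exact ⟨fun h => absurd h units_neg_one_ne_one, fun _ => h3⟩
    · have h3 := h.plus _ _ (by omega) (by omega) (ih.2 h1) (ej.trans ei.symm) (ej ▸ h2)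
      rw [h1, h2]
      exact ⟨fun h => absurd h units_neg_one_ne_one, fun _ => h3⟩
    · have h3 := h.minus _ _ (by omega) (by omega) (ih.2 h1) (ej.trans ei.symm) (ej ▸ h2)
      rw [h1, h2]
      exact ⟨fun _ => h3, fun h => absurd h.symm units_neg_one_ne_one⟩

/-- If the two factors that follow the neighbours of the last entry have a common repetition, then
one of them is twice as long as the other. -/
theorem Follows.length_of_repetition (h : Follows σ π w) {x y : ℕ} (hx : x < m) (hy : y < m)
    (hxe : entry π x = entry π m + 1) (hye : entry π y + 1 = entry π m) {u : Word r}
    (hux : ∀ i, u (i + (m - x)) = u i) (huy : ∀ i, u (i + (m - y)) = u i)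
    (hwx : ∀ i < m - x, w (x + i) = u i) (hwy : ∀ i < m - y, w (y + i) = u i) :
    m - y = (m - x) + (m - x) ∨ m - x = (m - y) + (m - y) := by
  have hper : Function.Periodic u ((m - x).gcd (m - y)) := periodic_gcd hux huy
  have hg : 0 < (m - x).gcd (m - y) := Nat.gcd_pos_of_pos_left _ (by omega)
  obtain ⟨a, ha⟩ := Nat.gcd_dvd_left (m - x) (m - y)
  obtain ⟨b, hb⟩ := Nat.gcd_dvd_right (m - x) (m - y)
  generalize (m - x).gcd (m - y) = g at hper hg ha hb
  have hu : ∀ k i, u (k * g + i) = u i := fun k i => by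
    rw [add_comm (k * g)]
    exact hper.nsmul k i
  have ha0 : 0 < a := Nat.pos_of_ne_zero (by rintro rfl; omega)
  have hb0 : 0 < b := Nat.pos_of_ne_zero (by rintro rfl; omega)
  have factor : ∀ z d, z < m → m - z = g * d → (∀ i < m - z, w (z + i) = u i) →
      ∀ c, c < d → ∀ t < g, (c + 1) * g ≤ m ∧ w (m - (c + 1) * g + t) = u t := by
    intro z d hz hd hw c hc t ht
    obtain ⟨k, rfl⟩ : ∃ k, d = c + 1 + k := ⟨d - (c + 1), by omega⟩
    rw [mul_add, mul_comm g (c + 1), mul_comm g k] at hd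
    refine ⟨by omega, ?_⟩
    have e : m - (c + 1) * g + t = z + (k * g + t) := by omega
    have h1 : g ≤ (c + 1) * g := Nat.le_mul_of_pos_left g (Nat.succ_pos c)
    rw [e, hw _ (by omega), hu]
  have factor' : ∀ c, c < max a b → ∀ t < g, (c + 1) * g ≤ m ∧
      w (m - (c + 1) * g + t) = u t := by
    intro c hc
    rcases lt_max_iff.mp hc with hc | hc
    · exact factor x a hx ha hwx c hc
    · exact factor y b hy hb hwy c hc
  have hle : ∀ c, c ≤ max a b → c * g ≤ m := by
    rintro (_ | c) hc
    · omega
    · exact (factor' c hc 0 hg).1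
  -- The entries read backwards from `m` in steps of `g`: `x` is reached after `a` steps and `y`
  -- after `b`. The factors between consecutive positions are all equal, so passing from `c + 1` to
  -- `c` preserves or reverses the order, according to the sign of one factor.
  let s : ℕ → ℤ := fun c => entry π (m - c * g)
  have hinj : ∀ c d, c ≤ max a b → d ≤ max a b → s c = s d → c = d := by
    intro c d hc hd he
    have h1 := entry_inj (Nat.sub_le _ _) (Nat.sub_le _ _) (Int.ofNat_inj.mp he)
    have h2 := hle c hc
    have h3 := hle d hd
    exact Nat.eq_of_mul_eq_mul_right hg (by omega)
  have hs0 : s 0 = entry π m := by simp [s]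
  have hsa : s a = s 0 + 1 := by
    have : m - a * g = x := by
      rw [mul_comm]
      omega
    rw [hs0]
    simp only [s]
    rw [this, hxe]
    rfl
  have hsb : s b = s 0 - 1 := by
    have : m - b * g = y := by
      rw [mul_comm]
      omega
    rw [hs0]
    simp only [s]
    rw [this, ← hye]
    push_cast
    ring
  have step : ∀ c d, c < max a b → d < max a b → s (c + 1) < s (d + 1) →
      (prefixSign σ u g = 1 → s c < s d) ∧ (prefixSign σ u g = -1 → s d < s c) := by
    intro c d hc hd hlt
    have h1 := hle (c + 1) hc
    have h2 := hle (d + 1) hd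
    have e1 : m - (c + 1) * g + g = m - c * g := by
      rw [Nat.succ_mul] at h1 ⊢
      omega
    have e2 : m - (d + 1) * g + g = m - d * g := by
      rw [Nat.succ_mul] at h2 ⊢
      omega
    have := h.of_factor (l := g) (i := m - (c + 1) * g) (j := m - (d + 1) * g) (by omega)
      (by omega) (fun t ht => (factor' c hc t ht).2) (fun t ht => (factor' d hd t ht).2)
      (Int.ofNat_lt.mp hlt)
    rw [e1, e2] at this
    exact ⟨fun hs => Int.ofNat_lt.mpr (this.1 hs), fun hs => Int.ofNat_lt.mpr (this.2 hs)⟩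
  rcases Int.units_eq_one_or (prefixSign σ u g) with hs | hs
  · exact (no_neighbours_of_increasing hinj (le_max_left a b) (le_max_right a b) hb0
      (fun c d hc hd hlt => (step c d hc hd hlt).1 hs) (by omega) (by omega)).elim
  · rcases neighbours_of_decreasing hinj (le_max_left a b) (le_max_right a b) ha0 hb0
      (fun c d hc hd hlt => (step c d hc hd hlt).2 hs) hsa hsb with ⟨rfl, rfl⟩ | ⟨rfl, rfl⟩
    · left
      omega
    · right
      omega

namespace Segmentation

variable (E : Segmentation σ π)

/-- Equality forces one length to be twice the other. The longer word is then the square of the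
shorter one, as both have the same repetition, and the segmentation is invalid. -/
theorem periodicWord_q_ne_periodicWord_p (hE : E.Valid) {x y : ℕ} (hx : x < m) (hy : y < m)
    (hxe : entry π x = entry π m + 1) (hye : entry π y + 1 = entry π m) :
    periodicWord ((List.ofFn E.assocWord).drop y) ≠
      periodicWord ((List.ofFn E.assocWord).drop x) := by
  intro he
  let w : Word r := appendWord E.assocWord (constWord 0)
  have hw : ∀ i : Fin m, w i = E.assocWord i := fun i => appendWord_apply_of_lt _ _ i.isLt
  have hlen : ∀ z, ((List.ofFn E.assocWord).drop z).length = m - z := fun z => by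
    rw [List.length_drop, List.length_ofFn]
  apply hE
  refine ⟨fun h0 => ?_, fun h0 => ?_, ?_⟩
  · rw [entry_last, h0, Fin.val_zero] at hye
    omega
  · have := entry_le π x
    rw [hxe, entry_last, h0, Fin.val_last] at this
    omega
  rw [E.p_eq_drop hx hxe, E.q_eq_drop hy hye]
  have hlen' := (E.follows hw).length_of_repetition hx hy hxe hye (E.periodicWord_drop_add x)
    (fun i => by rw [← he, E.periodicWord_drop_add])
    (fun i hi => (E.periodicWord_drop_apply hw hi).symm)
    (fun i hi => by rw [← he, E.periodicWord_drop_apply hw hi])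
  rcases hlen' with h | h
  · right
    refine eq_of_periodicWord_eq ?_ ?_
    · rw [List.length_append, hlen, hlen, h]
    · rw [periodicWord_append_self, he]
  · left
    refine eq_of_periodicWord_eq ?_ ?_
    · rw [List.length_append, hlen, hlen, h]
    · rw [periodicWord_append_self, he]

/-- With the tail `p^∞` at `m`, the tails at `x` and `m` coincide. The weak descent puts the tail at
`y` below them, and `compare_drop` turns the tail at `y` into `q^∞`. -/
theorem periodicWord_q_lessEq_periodicWord_p {x y : ℕ} (hx : x < m) (hy : y < m)
    (hxe : entry π x = entry π m + 1) (hye : entry π y + 1 = entry π m) :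
    LessEq σ (periodicWord ((List.ofFn E.assocWord).drop y))
      (periodicWord ((List.ofFn E.assocWord).drop x)) := by
  let w : Word r :=
    appendWord E.assocWord (periodicWord ((List.ofFn E.assocWord).drop x))
  have hw : ∀ i : Fin m, w i = E.assocWord i := fun i => appendWord_apply_of_lt _ _ i.isLt
  have hwm : shift^[m] w = periodicWord ((List.ofFn E.assocWord).drop x) :=
    iterate_shift_appendWord _ _
  have hwx : shift^[x] w = shift^[m] w := by
    funext i
    rw [hwm, iterate_shift_apply]
    rcases lt_or_ge i (m - x) with hi | hi
    · rw [E.periodicWord_drop_apply hw hi, add_comm x]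
    · have h1 := congrFun hwm (i - (m - x))
      rw [iterate_shift_apply] at h1
      have h2 := E.periodicWord_drop_add x (i - (m - x))
      rw [Nat.sub_add_cancel hi] at h2
      rw [h2, ← h1]
      congr 1
      omega
  have h := (E.follows hw).lessEq_of_periodic hx hxe hwx hy hx (by omega)
  rw [← hwm, ← not_less, (E.compare_drop hw hy).1, not_less, ← hwx]
  exact h

end Segmentation

end SignedShift

/-! ### Extreme last entries and existence of tails -/

namespace SignedShift

section ExtremeValues

variable {r : ℕ} {σ : Signature r}

theorem minWord_of_plus (h : σ 0 = 1) (i : ℕ) : minWord σ i = 0 := by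
  simp [minWord, h, constWord]

theorem maxWord_of_plus (h : σ (Fin.last r) = 1) (i : ℕ) : maxWord σ i = Fin.last r := by
  simp [maxWord, h, constWord]

theorem minWord_of_minus_of_plus (h : σ 0 = -1) (h' : σ (Fin.last r) = 1) {i : ℕ} (hi : 0 < i) :
    minWord σ i = Fin.last r := by
  obtain ⟨i, rfl⟩ : ∃ k, i = k + 1 := ⟨i - 1, by omega⟩
  simp [minWord, h, h', consWord, constWord]

theorem maxWord_of_minus_of_plus (h : σ (Fin.last r) = -1) (h' : σ 0 = 1) {i : ℕ} (hi : 0 < i) :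
    maxWord σ i = 0 := by
  obtain ⟨i, rfl⟩ : ∃ k, i = k + 1 := ⟨i - 1, by omega⟩
  simp [maxWord, h, h', consWord, constWord]

theorem minWord_of_minus (h : σ 0 = -1) (h' : σ (Fin.last r) = -1) (i : ℕ) :
    minWord σ i = if Even i then 0 else Fin.last r := by
  simp [minWord, h, h', altWord]

theorem maxWord_of_minus (h : σ 0 = -1) (h' : σ (Fin.last r) = -1) (i : ℕ) :
    maxWord σ i = if Even i then Fin.last r else 0 := by
  simp [maxWord, h, h', altWord]

end ExtremeValues

namespace Segmentation

variable {r m : ℕ} {σ : Signature r} {π : Equiv.Perm (Fin (m + 1))} (E : Segmentation σ π)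
  {w : Word r}

theorem entry_lt_of_eq_zero (hw : ∀ i : Fin m, w i = E.assocWord i) {i : ℕ} (hi : i < m)
    (h : w i = 0) : entry π i < E.e 1 := by
  have := (E.mem_block hw hi).2
  rw [h] at this
  exact this

theorem le_entry_of_eq_last (hw : ∀ i : Fin m, w i = E.assocWord i) {i : ℕ} (hi : i < m)
    (h : w i = Fin.last r) : E.e (Fin.last r).castSucc ≤ entry π i := by
  have := (E.mem_block hw hi).1
  rwa [h] at this

theorem val_last_sub_one (hm : 0 < m) : ((Fin.last m - 1 : Fin (m + 1)) : ℕ) = m - 1 := by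
  rw [Fin.val_sub_one_of_ne_zero, Fin.val_last]
  intro h0
  have := congrArg Fin.val h0
  rw [Fin.val_last, Fin.val_zero] at this
  omega

theorem val_one_of_pos (hm : 0 < m) : ((1 : Fin (m + 1)) : ℕ) = 1 := by
  rw [Fin.val_one', Nat.mod_eq_of_lt (by omega)]

/-- If `σ 0 = 1`, `p` would consist of zeros, and `Follows` leaves only the single letter that
`start_plus` excludes. If only `σ 0` is negative, the smallest word is not periodic. If both extreme
signs are negative, `p` would be a power of the word `0 r`, and `Follows` leaves only the
configuration excluded by `minus_start`. -/
theorem periodicWord_ne_minWord (hr : 1 ≤ r) {x : ℕ} (hx : x < m) (hm : entry π m = 0)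
    (hxe : entry π x = 1) : periodicWord ((List.ofFn E.assocWord).drop x) ≠ minWord σ := by
  intro he
  let w : Word r := appendWord E.assocWord (constWord 0)
  have hw : ∀ i : Fin m, w i = E.assocWord i := fun i => appendWord_apply_of_lt _ _ i.isLt
  have hwx : ∀ i < m - x, w (x + i) = minWord σ i := fun i hi => by
    rw [← he, E.periodicWord_drop_apply hw hi]
  have hlast : Fin.last r ≠ 0 := Fin.ne_of_gt (Fin.lt_def.mpr hr)
  have hper : minWord σ (m - x) = 0 := by
    have h := E.periodicWord_drop_add x 0
    rwa [he, zero_add, minWord_zero] at h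
  have hf := E.follows hw
  have hm0 : markedCycle π 0 = none := markedCycle_eq_none_iff.mpr hm
  have hx0 : w x = 0 := by
    have := hwx 0 (by omega)
    rwa [minWord_zero, add_zero] at this
  have hlt1 := E.entry_lt_of_eq_zero hw hx hx0
  have gt_of_ne : ∀ i < m, i ≠ x → entry π x < entry π i := by
    intro i hi hne
    have h1 : entry π i ≠ entry π x := fun h => hne (entry_inj hi.le hx.le h)
    have h2 : entry π i ≠ entry π m := fun h => hi.ne (entry_inj hi.le le_rfl h)
    omega
  rcases Int.units_eq_one_or (σ 0) with hs0 | hs0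
  · by_cases hx1 : x + 1 = m
    · have h1 := E.start_plus hs0 hm0 (markedCycle_eq_some_iff.mpr
        ⟨x, hx, by rw [hxe, val_one_of_pos (by omega)], by rw [hx1, hm, Fin.val_zero]⟩)
      omega
    · have hw1 : w (m - 1) = 0 := by
        have := hwx (m - 1 - x) (by omega)
        rwa [minWord_of_plus hs0, show x + (m - 1 - x) = m - 1 by omega] at this
      have := hf.plus x (m - 1) hx (by omega) (gt_of_ne _ (by omega) (by omega))
        (hx0.trans hw1.symm) (hx0 ▸ hs0)
      rw [Nat.sub_add_cancel (by omega), hm] at this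
      omega
  rcases Int.units_eq_one_or (σ (Fin.last r)) with hsr | hsr
  · rw [minWord_of_minus_of_plus hs0 hsr (by omega)] at hper
    exact hlast hper
  have hmin := minWord_of_minus hs0 hsr
  have heven : Even (m - x) := by
    by_contra hodd
    rw [hmin, if_neg hodd] at hper
    exact hlast hper
  obtain ⟨k, hk⟩ := heven
  have hw1 : w (m - 1) = Fin.last r := by
    have := hwx (m - 1 - x) (by omega)
    rwa [hmin, if_neg (Nat.not_even_iff_odd.mpr ⟨k - 1, by omega⟩),
      show x + (m - 1 - x) = m - 1 by omega] at this
  have hw2 : w (m - 2) = 0 := by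
    have := hwx (m - 2 - x) (by omega)
    rwa [hmin, if_pos ⟨k - 1, by omega⟩, show x + (m - 2 - x) = m - 2 by omega] at this
  -- An index `s` with a larger entry would also carry the letter `r`, whose negative sign would put
  -- the entry after `s` below the last entry, which is `0`.
  have hem : entry π (m - 1) = m := by
    by_contra hne
    obtain ⟨s, hsm, hse⟩ := exists_entry_eq π (le_refl m)
    have hs : s < m := lt_of_le_of_ne hsm (by rintro rfl; omega)
    have hlt : entry π (m - 1) < entry π s := by
      have := entry_le π (m - 1)
      omega
    have hws := hf.le _ _ (by omega) hs hlt
    rw [hw1] at hws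
    have := hf.minus _ _ (by omega) hs hlt (hw1.trans (Fin.last_le_iff.mp hws).symm) (hw1 ▸ hsr)
    rw [Nat.sub_add_cancel (by omega), hm] at this
    omega
  -- Otherwise `x` and `m - 2` share the letter `0` with negative sign, and the entry after `x`
  -- would exceed the maximum, which is at `m - 1`.
  have hx2 : x = m - 2 := by
    by_contra hne
    have := hf.minus x (m - 2) hx (by omega) (gt_of_ne _ (by omega) (Ne.symm hne))
      (hx0.trans hw2.symm) (hx0 ▸ hs0)
    rw [show m - 2 + 1 = m - 1 by omega, hem] at this
    have := entry_le π (x + 1)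
    omega
  have h1 := E.minus_start hs0 hsr hm0
    (markedCycle_eq_some_iff.mpr ⟨x, hx, by rw [hxe, val_one_of_pos (by omega)], by
      rw [show x + 1 = m - 1 by omega, hem, Fin.val_last]⟩)
    (markedCycle_eq_some_iff.mpr ⟨m - 1, by omega, by rw [hem, Fin.val_last], by
      rw [show m - 1 + 1 = m by omega, hm, Fin.val_zero]⟩)
  have h2 := E.le_entry_of_eq_last hw (show m - 1 < m by omega) hw1
  omega

/-- The mirror image of `periodicWord_ne_minWord`: the surviving configurations are those excluded
by `end_plus` and `minus_end`. -/
theorem periodicWord_ne_maxWord (hr : 1 ≤ r) {y : ℕ} (hy : y < m) (hm : entry π m = m)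
    (hye : entry π y + 1 = m) : periodicWord ((List.ofFn E.assocWord).drop y) ≠ maxWord σ := by
  intro he
  let w : Word r := appendWord E.assocWord (constWord 0)
  have hw : ∀ i : Fin m, w i = E.assocWord i := fun i => appendWord_apply_of_lt _ _ i.isLt
  have hwy : ∀ i < m - y, w (y + i) = maxWord σ i := fun i hi => by
    rw [← he, E.periodicWord_drop_apply hw hi]
  have hlast : Fin.last r ≠ 0 := Fin.ne_of_gt (Fin.lt_def.mpr hr)
  have hper : maxWord σ (m - y) = Fin.last r := by
    have h := E.periodicWord_drop_add y 0
    rwa [he, zero_add, maxWord_zero] at h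
  have hf := E.follows hw
  have hm0 : markedCycle π (Fin.last m) = none := markedCycle_eq_none_iff.mpr hm
  have hy0 : w y = Fin.last r := by
    have := hwy 0 (by omega)
    rwa [maxWord_zero, add_zero] at this
  have hle := E.le_entry_of_eq_last hw hy hy0
  have lt_of_ne : ∀ i < m, i ≠ y → entry π i < entry π y := by
    intro i hi hne
    have h1 : entry π i ≠ entry π y := fun h => hne (entry_inj hi.le hy.le h)
    have h2 : entry π i ≠ entry π m := fun h => hi.ne (entry_inj hi.le le_rfl h)
    have := entry_le π i
    omega
  rcases Int.units_eq_one_or (σ (Fin.last r)) with hsr | hsr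
  · by_cases hy1 : y + 1 = m
    · have h1 := E.end_plus hsr (markedCycle_eq_some_iff.mpr
        ⟨y, hy, by rw [val_last_sub_one (by omega)]; omega, by rw [hy1, hm, Fin.val_last]⟩) hm0
      omega
    · have hw1 : w (m - 1) = Fin.last r := by
        have := hwy (m - 1 - y) (by omega)
        rwa [maxWord_of_plus hsr, show y + (m - 1 - y) = m - 1 by omega] at this
      have := hf.plus (m - 1) y (by omega) hy (lt_of_ne _ (by omega) (by omega))
        (hw1.trans hy0.symm) (hw1 ▸ hsr)
      rw [Nat.sub_add_cancel (by omega), hm] at this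
      have := entry_le π (y + 1)
      omega
  rcases Int.units_eq_one_or (σ 0) with hs0 | hs0
  · rw [maxWord_of_minus_of_plus hsr hs0 (by omega)] at hper
    exact hlast hper.symm
  have hmax := maxWord_of_minus hs0 hsr
  have heven : Even (m - y) := by
    by_contra hodd
    rw [hmax, if_neg hodd] at hper
    exact hlast hper.symm
  obtain ⟨k, hk⟩ := heven
  have hw1 : w (m - 1) = 0 := by
    have := hwy (m - 1 - y) (by omega)
    rwa [hmax, if_neg (Nat.not_even_iff_odd.mpr ⟨k - 1, by omega⟩),
      show y + (m - 1 - y) = m - 1 by omega] at this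
  have hw2 : w (m - 2) = Fin.last r := by
    have := hwy (m - 2 - y) (by omega)
    rwa [hmax, if_pos ⟨k - 1, by omega⟩, show y + (m - 2 - y) = m - 2 by omega] at this
  have hem : entry π (m - 1) = 0 := by
    by_contra hne
    obtain ⟨s, hsm, hse⟩ := exists_entry_eq π (Nat.zero_le m)
    have hs : s < m := lt_of_le_of_ne hsm (by rintro rfl; omega)
    have hlt : entry π s < entry π (m - 1) := by omega
    have hws := hf.le _ _ hs (by omega) hlt
    rw [hw1] at hws
    have hws0 : w s = 0 := le_antisymm hws (Fin.zero_le _)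
    have := hf.minus _ _ hs (by omega) hlt (hws0.trans hw1.symm) (hws0 ▸ hs0)
    rw [Nat.sub_add_cancel (by omega), hm] at this
    have := entry_le π (s + 1)
    omega
  have hy2 : y = m - 2 := by
    by_contra hne
    have := hf.minus (m - 2) y (by omega) hy (lt_of_ne _ (by omega) (Ne.symm hne))
      (hw2.trans hy0.symm) (hw2 ▸ hsr)
    rw [show m - 2 + 1 = m - 1 by omega, hem] at this
    omega
  have h1 := E.minus_end hs0 hsr
    (markedCycle_eq_some_iff.mpr ⟨m - 1, by omega, by rw [hem, Fin.val_zero], by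
      rw [show m - 1 + 1 = m by omega, hm, Fin.val_last]⟩)
    (markedCycle_eq_some_iff.mpr ⟨y, hy, by rw [val_last_sub_one (by omega)]; omega, by
      rw [show y + 1 = m - 1 by omega, hem, Fin.val_zero]⟩) hm0
  have h2 := E.entry_lt_of_eq_zero hw (show m - 1 < m by omega) hw1
  omega

/-- A valid segmentation has an admissible tail. -/
theorem exists_tail (hr : 1 ≤ r) (hE : E.Valid) : ∃ v, E.LowerBound v ∧ E.UpperBound v := by
  have next : entry π m ≠ m → ∃ x < m, entry π x = entry π m + 1 := by
    intro h
    obtain ⟨x, hxm, hxe⟩ := exists_entry_eq π (c := entry π m + 1) (by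
      have := entry_le π m
      omega)
    exact ⟨x, lt_of_le_of_ne hxm (by rintro rfl; omega), hxe⟩
  have prev : entry π m ≠ 0 → ∃ y < m, entry π y + 1 = entry π m := by
    intro h
    obtain ⟨y, hym, hye⟩ := exists_entry_eq π (c := entry π m - 1) (by
      have := entry_le π m
      omega)
    exact ⟨y, lt_of_le_of_ne hym (by rintro rfl; omega), by omega⟩
  by_cases h0 : entry π m = 0 <;> by_cases hm : entry π m = m
  · exact ⟨minWord σ, E.lowerBound_of_eq_zero h0 _, E.upperBound_of_eq_last hm _⟩
  · obtain ⟨x, hx, hxe⟩ := next hm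
    refine ⟨minWord σ, E.lowerBound_of_eq_zero h0 _, ?_⟩
    rw [E.upperBound_iff hx hxe]
    exact (minWord_lessEq σ _).resolve_right
      (E.periodicWord_ne_minWord hr hx h0 (by omega)).symm
  · obtain ⟨y, hy, hye⟩ := prev h0
    refine ⟨maxWord σ, ?_, E.upperBound_of_eq_last hm _⟩
    rw [E.lowerBound_iff hy hye]
    exact (lessEq_maxWord σ _).resolve_right
      (E.periodicWord_ne_maxWord hr hy hm (by omega))
  · obtain ⟨x, hx, hxe⟩ := next hm
    obtain ⟨y, hy, hye⟩ := prev h0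
    have hlt := (E.periodicWord_q_lessEq_periodicWord_p hx hy hxe hye).resolve_right
      (E.periodicWord_q_ne_periodicWord_p hE hx hy hxe hye)
    -- The order on words has gaps in general, so periodicity of `q^∞` is what provides a word
    -- strictly between the bounds.
    obtain ⟨v, h1, h2⟩ := exists_between_of_periodic (Nat.sub_pos_of_lt hy)
      (E.periodicWord_drop_add y) hlt
    exact ⟨v, (E.lowerBound_iff hy hye v).mpr h1, (E.upperBound_iff hx hxe v).mpr h2⟩

theorem isInterval_allowedInterval : IsInterval σ E.allowedInterval := by
  have hl : ∃ (b : Prop) (lo : Word r), ∀ v, E.LowerBound v ↔ Rel σ b lo v := by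
    by_cases h : π (Fin.last m) = 0
    · exact ⟨True, minWord σ, fun v => by rw [LowerBound, if_pos h, Rel, LessEq, true_and]⟩
    · exact ⟨False, periodicWord E.q, fun v => by
        rw [LowerBound, if_neg h, Rel, false_and, or_false]⟩
  have hu : ∃ (b : Prop) (hi : Word r), ∀ v, E.UpperBound v ↔ Rel σ b v hi := by
    by_cases h : π (Fin.last m) = Fin.last m
    · exact ⟨True, maxWord σ, fun v => by rw [UpperBound, if_pos h, Rel, LessEq, true_and]⟩
    · exact ⟨False, periodicWord E.p, fun v => by
        rw [UpperBound, if_neg h, Rel, false_and, or_false]⟩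
  obtain ⟨b, lo, hl⟩ := hl
  obtain ⟨b', hi, hu⟩ := hu
  unfold allowedInterval
  simp only [hl, hu]
  exact isInterval_appendWord E.assocWord b b' lo hi

theorem mem_allowedInterval_iff : w ∈ E.allowedInterval ↔ (∀ i : Fin m, w i = E.assocWord i) ∧
    E.LowerBound (shift^[m] w) ∧ E.UpperBound (shift^[m] w) := by
  constructor
  · rintro ⟨v, hl, hu, h⟩
    obtain ⟨h1, rfl⟩ := (appendWord_eq_iff _ _ _).mp h
    exact ⟨h1, hl, hu⟩
  · rintro ⟨h, hl, hu⟩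
    exact ⟨_, hl, hu, (appendWord_eq_iff _ _ _).mpr ⟨h, rfl⟩⟩

end Segmentation

/-! ### Assembling the theorem -/

theorem hasPattern_iff_exists_segmentation {r m : ℕ} {σ : Signature r}
    {π : Equiv.Perm (Fin (m + 1))} {w : Word r} : HasPattern (Less σ) shift w π ↔
      ∃ E : Segmentation σ π, E.Valid ∧ (∀ i : Fin m, w i = E.assocWord i) ∧
        E.LowerBound (shift^[m] w) ∧ E.UpperBound (shift^[m] w) := by
  constructor
  · intro h
    obtain ⟨E, hw⟩ := exists_segmentation h
    obtain ⟨hl, hu⟩ := (E.hasPattern_iff_bounds hw).mp h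
    exact ⟨E, E.valid_of_bounds hl hu, hw, hl, hu⟩
  · rintro ⟨E, -, hw, h⟩
    exact (E.hasPattern_iff_bounds hw).mpr h

end SignedShift

theorem mainTheorem2 {r m : ℕ} (hr : 1 ≤ r) (σ : SignedShift.Signature r)
    (π : Equiv.Perm (Fin (m + 1))) :
    (∀ w : SignedShift.Word r,
      SignedShift.HasPattern (SignedShift.Less σ) SignedShift.shift w π ↔
        ∃ E : SignedShift.Segmentation σ π, E.Valid ∧
          (∀ i : Fin m, w i = E.assocWord i) ∧
          E.LowerBound (SignedShift.shift^[m] w) ∧ E.UpperBound (SignedShift.shift^[m] w)) ∧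
    SignedShift.inducing σ π =
      (⋃ E ∈ {E : SignedShift.Segmentation σ π | E.Valid}, E.allowedInterval) ∧
    {E : SignedShift.Segmentation σ π | E.Valid}.Finite ∧
    {E : SignedShift.Segmentation σ π | E.Valid}.PairwiseDisjoint
      SignedShift.Segmentation.allowedInterval ∧
    (∀ E : SignedShift.Segmentation σ π, E.Valid →
      SignedShift.IsInterval σ E.allowedInterval ∧ E.allowedInterval.Nonempty) := by
  refine ⟨fun w => SignedShift.hasPattern_iff_exists_segmentation, ?_, ?_, ?_, ?_⟩
  · ext w
    simp only [Set.mem_iUnion, Set.mem_ofPred_eq, exists_prop,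
      SignedShift.Segmentation.mem_allowedInterval_iff]
    exact SignedShift.hasPattern_iff_exists_segmentation
  · have := SignedShift.Segmentation.finite_segmentation (σ := σ) (π := π)
    exact Set.toFinite _
  · intro E _ F _ hne
    refine Set.disjoint_left.mpr fun w hE hF => hne ?_
    rw [SignedShift.Segmentation.mem_allowedInterval_iff] at hE hF
    exact SignedShift.Segmentation.assocWord_injective
      (funext fun i => (hE.1 i).symm.trans (hF.1 i))
  · intro E hE
    refine ⟨E.isInterval_allowedInterval, ?_⟩
    obtain ⟨v, hl, hu⟩ := E.exists_tail hr hE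
    exact ⟨_, v, hl, hu, rfl⟩
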